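/- Let $G$ be a countable discrete group. A sequence $(F_n)_{n\ge 1}$ of finite subsets of $G$ with $e\in F_1\subseteq F_2\subseteq\dotsb$ and $\bigcup_n F_n=G$ is called right Følner if $\lim_{n\to\infty}|F_n\triangle F_ns|/|F_n|=0$ for every $s\in G$, and left Følner if $\lim_{n\to\infty}|F_n\triangle sF_n|/|F_n|=0$ for every $s\in G$; $G$ is amenable if it has a right Følner sequence. Suppose that $G$ is countable, amenable and residually finite, and let $L_1\supseteq L_2\supseteq\dotsb$ be normal subgroups of finite index in $G$ that separate points, i.e. for every $g\ne e$ there is $n$ with $g\notin L_n$. Then there exist finite subsets $K_n\subseteq G$ $(n\ge 1)$ and integers $1\le n_1<n_2<\dotsb$ such that: 1. $(K_n)_n$ is both a left and a right Følner sequence, and for every $n\ge 1$ the decomposition $G=K_nL_n$ is a tiling, i.e. every $x\in G$ can be written in exactly one way as $x=kl$ with $k\in K_n$ and $l\in L_n$; 2. for every $k\ge 1$, $K_{n_{k+1}}$ is a disjoint union of right translates of $K_{n_k}$, i.e. there is a finite set $T\subseteq G$ such that the sets $K_{n_k}t$ $(t\in T)$ are pairwise disjoint and their union is $K_{n_{k+1}}$.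 -/

import Mathlib

open scoped symmDiff Topology

/-- A right Følner sequence: finite sets `1 ∈ F 0 ⊆ F 1 ⊆ ⋯` that exhaust `G`, with
`|F n ∆ F n s| / |F n| → 0` for every `s`. -/
structure IsRightFolnerSeq {G : Type*} [Group G] [DecidableEq G] (F : ℕ → Finset G) : Prop where
  one_mem : (1 : G) ∈ F 0
  mono : Monotone F
  exhaust : ∀ g : G, ∃ n, g ∈ F n
  tendsto : ∀ s : G, Filter.Tendsto
    (fun n => ((F n ∆ (F n).image (fun x => x * s)).card : ℝ) / ((F n).card : ℝ))
    Filter.atTop (𝓝 0)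

/-- A left Følner sequence: finite sets `1 ∈ F 0 ⊆ F 1 ⊆ ⋯` that exhaust `G`, with
`|F n ∆ s F n| / |F n| → 0` for every `s`. -/
structure IsLeftFolnerSeq {G : Type*} [Group G] [DecidableEq G] (F : ℕ → Finset G) : Prop where
  one_mem : (1 : G) ∈ F 0
  mono : Monotone F
  exhaust : ∀ g : G, ∃ n, g ∈ F n
  tendsto : ∀ s : G, Filter.Tendsto
    (fun n => ((F n ∆ (F n).image (fun x => s * x)).card : ℝ) / ((F n).card : ℝ))
    Filter.atTop (𝓝 0)

/-- A (countable, discrete) group is amenable if it has a right Følner sequence. -/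
def IsAmenableGroup (G : Type*) [Group G] [DecidableEq G] : Prop :=
  ∃ F : ℕ → Finset G, IsRightFolnerSeq F

/-- `L` is a separating nested sequence of finite-index normal subgroups. -/
structure IsSeparatingNestedSeq {G : Type*} [Group G] (L : ℕ → Subgroup G) : Prop where
  normal : ∀ n, (L n).Normal
  finiteIndex : ∀ n, (L n).FiniteIndex
  nested : Antitone L
  separating : ∀ g : G, g ≠ 1 → ∃ n, g ∉ L n

/-- `B` is a disjoint union of right translates `A t` of `A`. -/
def IsDisjointUnionOfRightTranslates {G : Type*} [Group G] [DecidableEq G]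
    (A B : Finset G) : Prop :=
  ∃ T : Finset G,
    (T : Set G).PairwiseDisjoint (fun t => A.image (fun x => x * t)) ∧
    B = T.biUnion (fun t => A.image (fun x => x * t))

/-! `G` is viewed as a `G × G`-set under left and right multiplication. Transversals of the `L j`
with small relative boundary under each element of `G × G` are left and right Følner simultaneously,
and `defect` adds up all these boundaries with summable weights. For infinite `G` three problems
remain: almost invariant transversals, nesting, and tiling.

Almost invariant transversals come from random orders (`exists_almost_equivariant_section`). Let `X`
be an almost invariant finite subset of `G × G`. Each point `q` of the finite quotient selects the
first point of `X⁻¹ • q` in a random order and transports a lift of it back over `q`. Since `X⁻¹ •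
q` and `X⁻¹ • (s • q)` nearly coincide, `q` and `s • q` usually select the same point, and the
resulting section is equivariant there unless a short element fixes `q` but moves a lift of `q`.
Such points are rare far along the sequence (`eventually_card_bad_le`).

For nesting, `extendMod` completes a set `E` by points of a transversal `R`, at boundary cost at
most `2 * defect w E + defect w R`. Each strict drop of `L j` at least doubles the index, so the
relative contribution of `E` dies out (`exists_chunk`, `exists_chain`).

For tiling, a transversal `K` of `P` cuts `G` into blocks `K * l` with `l ∈ P`. A set with small
boundary is close to a union of blocks, but a nested chain has to keep an earlier `C J` that is not
such a union. The block hull `H` of `C J` fits into a transversal only once `L m` separates its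
points. Until then the chain is made of whole blocks only off the cosets meeting `H`; afterwards it
contains `H` and consists of blocks (`exists_blocky_chain`). Each stage also puts one prescribed
element of `G` into `H`, and the concatenated stages exhaust `G`. -/

/-- The two-sided action of `G × G` on `G` by `(a, b) • x = a * x * b⁻¹`. -/
instance twoSidedAction {G : Type*} [Group G] : MulAction (G × G) G where
  smul γ x := γ.1 * x * γ.2⁻¹
  one_smul x := by change (1 : G) * x * (1 : G)⁻¹ = x; simp
  mul_smul γ η x := by
    change (γ.1 * η.1) * x * (γ.2 * η.2)⁻¹ = γ.1 * (η.1 * x * η.2⁻¹) * γ.2⁻¹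
    group

theorem twoSided_smul_def {G : Type*} [Group G] (γ : G × G) (x : G) :
    γ • x = γ.1 * x * γ.2⁻¹ := rfl

/-- The two-sided action of `G × G` on a quotient group of `G`. -/
instance twoSidedQuotientAction {G : Type*} [Group G] (M : Subgroup G) [M.Normal] :
    MulAction (G × G) (G ⧸ M) where
  smul γ q := (γ.1 : G ⧸ M) * q * (γ.2 : G ⧸ M)⁻¹
  one_smul q := by
    change ((1 : G) : G ⧸ M) * q * ((1 : G) : G ⧸ M)⁻¹ = q
    simp
  mul_smul γ η q := by
    change ((γ.1 * η.1 : G) : G ⧸ M) * q * ((γ.2 * η.2 : G) : G ⧸ M)⁻¹ =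
      (γ.1 : G ⧸ M) * ((η.1 : G ⧸ M) * q * (η.2 : G ⧸ M)⁻¹) * (γ.2 : G ⧸ M)⁻¹
    simp only [QuotientGroup.mk_mul]
    group

theorem coe_twoSided_smul {G : Type*} [Group G] (M : Subgroup G) [M.Normal] (γ : G × G) (x : G) :
    ((γ • x : G) : G ⧸ M) = γ • (x : G ⧸ M) := rfl

/-- The number of points of `K` that `γ` moves out of `K`. -/
def boundaryCard {G : Type*} [Group G] [DecidableEq G] (γ : G × G) (K : Finset G) : ℕ :=
  (K.filter (fun x => γ • x ∉ K)).card

/-! ### Transversals, two-sided boundaries and completion of partial transversals. -/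

section Basic

variable {G : Type*} [Group G]

/-- `K` has at most one point in each coset of `M`. -/
def SepMod (M : Subgroup G) (K : Finset G) : Prop :=
  ∀ x ∈ K, ∀ y ∈ K, (x : G ⧸ M) = y → x = y

/-- `K` has exactly one point in each coset of `M`. -/
structure IsTransv (M : Subgroup G) (K : Finset G) : Prop where
  sep : SepMod M K
  cover : ∀ g : G, ∃ x ∈ K, (x : G ⧸ M) = g

theorem SepMod.mono {M : Subgroup G} {K K' : Finset G} (h : SepMod M K) (hK : K' ⊆ K) :
    SepMod M K' := fun x hx y hy hxy => h x (hK hx) y (hK hy) hxy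

theorem quotient_eq_of_le {M M' : Subgroup G} (hM : M' ≤ M) {x y : G}
    (h : (x : G ⧸ M') = y) : (x : G ⧸ M) = y := by
  rw [QuotientGroup.eq] at h ⊢
  exact hM h

theorem SepMod.of_le {M M' : Subgroup G} {K : Finset G} (h : SepMod M K) (hM : M' ≤ M) :
    SepMod M' K := fun x hx y hy hxy => h x hx y hy (quotient_eq_of_le hM hxy)

theorem SepMod.card_le {M : Subgroup G} [M.FiniteIndex] {K : Finset G} (h : SepMod M K) :
    K.card ≤ M.index := by
  have : Fintype (G ⧸ M) := M.fintypeQuotientOfFiniteIndex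
  rw [Subgroup.index_eq_card, Nat.card_eq_fintype_card, ← Finset.card_univ]
  exact Finset.card_le_card_of_injOn (fun x => (x : G ⧸ M)) (by simp) (fun x hx y hy => h x hx y hy)

theorem IsTransv.card {M : Subgroup G} {K : Finset G} (h : IsTransv M K) :
    K.card = M.index := by
  rw [Subgroup.index_eq_card, ← Nat.card_eq_finsetCard]
  refine Nat.card_congr (Equiv.ofBijective (fun x : K => ((x : G) : G ⧸ M)) ⟨?_, ?_⟩)
  · rintro ⟨x, hx⟩ ⟨y, hy⟩ hxy
    exact Subtype.ext (h.sep x hx y hy hxy)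
  · intro q
    obtain ⟨g, rfl⟩ := QuotientGroup.mk_surjective q
    obtain ⟨x, hx, hxg⟩ := h.cover g
    exact ⟨⟨x, hx⟩, hxg⟩

theorem IsTransv.isComplement {M : Subgroup G} {K : Finset G} (h : IsTransv M K) :
    Subgroup.IsComplement (K : Set G) (M : Set G) := by
  rw [Subgroup.isComplement_iff_existsUnique_inv_mul_mem]
  intro g
  obtain ⟨x, hx, hxg⟩ := h.cover g
  refine ⟨⟨x, hx⟩, QuotientGroup.eq.1 hxg, ?_⟩
  rintro ⟨y, hy⟩ hyg
  exact Subtype.ext (h.sep y hy x hx ((QuotientGroup.eq.2 hyg).trans hxg.symm))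

variable [DecidableEq G]

theorem boundaryCard_le_card (γ : G × G) (K : Finset G) : boundaryCard γ K ≤ K.card :=
  Finset.card_filter_le _ _

theorem boundaryCard_inv (γ : G × G) (K : Finset G) :
    boundaryCard γ⁻¹ K = boundaryCard γ K := by
  have hK : ∀ η : G × G, (K.filter (fun x => η • x ∈ K)).card + boundaryCard η K = K.card :=
    fun η => Finset.card_filter_add_card_filter_not (s := K) _
  have h1 := hK γ
  have h2 := hK γ⁻¹
  have h3 : (K.filter (fun x => γ • x ∈ K)).card = (K.filter (fun x => γ⁻¹ • x ∈ K)).card := by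
    refine Finset.card_bij (fun x _ => γ • x) ?_ ?_ ?_
    · intro x hx
      simp only [Finset.mem_filter] at hx ⊢
      simpa using hx.symm
    · intro x _ y _ h
      simpa using h
    · intro y hy
      simp only [Finset.mem_filter] at hy
      exact ⟨γ⁻¹ • y, by simpa using hy.symm, by simp⟩
  omega

theorem boundaryCard_le_of_card_eq (γ : G × G) {K K' : Finset G} (h : K'.card = K.card) :
    boundaryCard γ K' ≤ boundaryCard γ K + 2 * (K' \ K).card := by
  have hsub : K'.filter (fun x => γ • x ∉ K') ⊆
      K.filter (fun x => γ • x ∉ K) ∪ (K' \ K) ∪ (K \ K').image (fun y => γ⁻¹ • y) := by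
    intro x hx
    simp only [Finset.mem_filter, Finset.mem_union, Finset.mem_sdiff, Finset.mem_image] at hx ⊢
    by_cases h1 : x ∈ K
    · by_cases h2 : γ • x ∈ K
      · exact Or.inr ⟨γ • x, ⟨h2, hx.2⟩, by simp⟩
      · exact Or.inl (Or.inl ⟨h1, h2⟩)
    · exact Or.inl (Or.inr ⟨hx.1, h1⟩)
  have h1 := Finset.card_le_card hsub
  have h2 := Finset.card_union_le (K.filter (fun x => γ • x ∉ K) ∪ (K' \ K))
    ((K \ K').image (fun y => γ⁻¹ • y))
  have h3 := Finset.card_union_le (K.filter (fun x => γ • x ∉ K)) (K' \ K)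
  have h4 : ((K \ K').image (fun y => γ⁻¹ • y)).card ≤ (K \ K').card := Finset.card_image_le
  have h5 : (K \ K').card = (K' \ K).card := Finset.card_sdiff_comm h.symm
  unfold boundaryCard
  omega

open scoped Classical in
/-- `E` together with the points of `R` in the cosets of `M` that do not meet `E`. -/
noncomputable def extendMod (M : Subgroup G) (E R : Finset G) : Finset G :=
  E ∪ R.filter (fun r => ∀ e ∈ E, (e : G ⧸ M) ≠ r)

theorem mem_extendMod {M : Subgroup G} {E R : Finset G} {x : G} :
    x ∈ extendMod M E R ↔ x ∈ E ∨ (x ∈ R ∧ ∀ e ∈ E, (e : G ⧸ M) ≠ x) := by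
  simp [extendMod]

theorem subset_extendMod (M : Subgroup G) (E R : Finset G) : E ⊆ extendMod M E R :=
  fun _ hx => mem_extendMod.2 (Or.inl hx)

theorem SepMod.extendMod {M : Subgroup G} {E R : Finset G} (hE : SepMod M E) (hR : SepMod M R) :
    SepMod M (extendMod M E R) := by
  intro x hx y hy hxy
  rcases mem_extendMod.1 hx with hx | hx <;> rcases mem_extendMod.1 hy with hy | hy
  · exact hE x hx y hy hxy
  · exact absurd hxy (hy.2 x hx)
  · exact absurd hxy.symm (hx.2 y hy)
  · exact hR x hx.1 y hy.1 hxy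

theorem exists_mem_extendMod_right {M : Subgroup G} {E R : Finset G} {g : G}
    (h : ∃ x ∈ R, (x : G ⧸ M) = g) : ∃ x ∈ extendMod M E R, (x : G ⧸ M) = g := by
  obtain ⟨x, hx, hxg⟩ := h
  by_cases hE : ∀ e ∈ E, (e : G ⧸ M) ≠ x
  · exact ⟨x, mem_extendMod.2 (Or.inr ⟨hx, hE⟩), hxg⟩
  · push Not at hE
    obtain ⟨e, he, hex⟩ := hE
    exact ⟨e, subset_extendMod M E R he, hex.trans hxg⟩

theorem IsTransv.extendMod {M : Subgroup G} {E R : Finset G} (hE : SepMod M E)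
    (hR : IsTransv M R) : IsTransv M (extendMod M E R) :=
  ⟨hE.extendMod hR.sep, fun g => exists_mem_extendMod_right (hR.cover g)⟩

theorem IsTransv.extendMod_eq {M : Subgroup G} {E R : Finset G} (hE : IsTransv M E) :
    _root_.extendMod M E R = E := by
  refine Finset.Subset.antisymm (fun x hx => ?_) (subset_extendMod M E R)
  rcases mem_extendMod.1 hx with hx | hx
  · exact hx
  · obtain ⟨e, he, hex⟩ := hE.cover x
    exact absurd hex (hx.2 e he)

/-- A smaller subgroup has smaller cosets, so fewer points of `R` are discarded for sharing a coset
with `E`. -/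
theorem extendMod_mono {M M' : Subgroup G} (hM : M' ≤ M) (E : Finset G) {R R' : Finset G}
    (hR : R ⊆ R') : extendMod M E R ⊆ extendMod M' E R' := by
  intro x hx
  rcases mem_extendMod.1 hx with hx | hx
  · exact subset_extendMod _ _ _ hx
  · exact mem_extendMod.2 (Or.inr ⟨hR hx.1, fun e he h => hx.2 e he (quotient_eq_of_le hM h)⟩)

/-- Besides the boundaries of `E` and `R`, the only loss is at added points `x` whose image lies in
`R` but was discarded because its coset contains some `e ∈ E`. Then `γ⁻¹ • e` lies in the coset of
`x`, which misses `E`, so `e` is a boundary point of `E` for `γ⁻¹`; as `R` is separated, `e`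
determines `x`. -/
theorem boundaryCard_extendMod_le (γ : G × G) (M : Subgroup G) [M.Normal] (E : Finset G)
    {R : Finset G} (hR : SepMod M R) :
    boundaryCard γ (extendMod M E R) ≤ 2 * boundaryCard γ E + boundaryCard γ R := by
  classical
  set A := R.filter (fun x : G => (∀ e ∈ E, (e : G ⧸ M) ≠ x) ∧ ∃ e ∈ E, (e : G ⧸ M) = (γ • x : G))
  have hA : A.card ≤ boundaryCard γ⁻¹ E := by
    have hch : ∀ x ∈ A, ∃ e ∈ E, (e : G ⧸ M) = (γ • x : G) := fun x hx =>
      (Finset.mem_filter.1 hx).2.2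
    choose! f hfE hf using hch
    have hf' : ∀ x ∈ A, ((γ⁻¹ • f x : G) : G ⧸ M) = x := by
      intro x hx
      rw [coe_twoSided_smul, hf x hx, coe_twoSided_smul, inv_smul_smul]
    refine Finset.card_le_card_of_injOn f ?_ ?_
    · intro x hx
      refine Finset.mem_filter.2 ⟨hfE x hx, fun h => ?_⟩
      exact (Finset.mem_filter.1 hx).2.1 _ h (hf' x hx)
    · intro x hx y hy hxy
      refine hR x (Finset.mem_filter.1 hx).1 y (Finset.mem_filter.1 hy).1 ?_
      rw [← hf' x hx, ← hf' y hy, hxy]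
  have hsub : (extendMod M E R).filter (fun x => γ • x ∉ extendMod M E R) ⊆
      E.filter (fun x => γ • x ∉ E) ∪ A ∪ R.filter (fun x => γ • x ∉ R) := by
    intro x hx
    obtain ⟨hx1, hx2⟩ := Finset.mem_filter.1 hx
    rw [mem_extendMod] at hx1 hx2
    push Not at hx2
    simp only [Finset.mem_union, Finset.mem_filter, A]
    rcases hx1 with hx1 | hx1
    · exact Or.inl (Or.inl ⟨hx1, hx2.1⟩)
    · by_cases h : γ • x ∈ R
      · exact Or.inl (Or.inr ⟨hx1.1, hx1.2, hx2.2 h⟩)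
      · exact Or.inr ⟨hx1.1, h⟩
  have h1 := Finset.card_le_card hsub
  have h2 := Finset.card_union_le (E.filter (fun x => γ • x ∉ E) ∪ A)
    (R.filter (fun x => γ • x ∉ R))
  have h3 := Finset.card_union_le (E.filter (fun x => γ • x ∉ E)) A
  rw [boundaryCard_inv] at hA
  unfold boundaryCard at *
  omega

end Basic

/-! ### First elements in a uniformly random order. -/

section RandomOrder

variable {Z : Type*} [Fintype Z]

/-- `u` is the element of `U` that comes first in the order given by `e`. -/
def IsFirst (e : Z ≃ Fin (Fintype.card Z)) (U : Finset Z) (u : Z) : Prop :=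
  u ∈ U ∧ ∀ v ∈ U, e u ≤ e v

theorem exists_isFirst (e : Z ≃ Fin (Fintype.card Z)) {U : Finset Z} (hU : U.Nonempty) :
    ∃ u, IsFirst e U u := U.exists_min_image e hU

theorem IsFirst.unique {e : Z ≃ Fin (Fintype.card Z)} {U : Finset Z} {u v : Z}
    (hu : IsFirst e U u) (hv : IsFirst e U v) : u = v :=
  e.injective (le_antisymm (hu.2 v hv.1) (hv.2 u hu.1))

variable [DecidableEq Z]

open scoped Classical in
-- Precomposing orders with the transposition of `u` and `v` exchanges the two families.
theorem card_isFirst_eq {U : Finset Z} {u v : Z} (hu : u ∈ U) (hv : v ∈ U) :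
    (Finset.univ.filter (fun e : Z ≃ Fin (Fintype.card Z) => IsFirst e U u)).card =
      (Finset.univ.filter (fun e : Z ≃ Fin (Fintype.card Z) => IsFirst e U v)).card := by
  have hswap : ∀ z ∈ U, Equiv.swap u v z ∈ U := by
    intro z hz
    rcases eq_or_ne z u with rfl | h1
    · simpa using hv
    rcases eq_or_ne z v with rfl | h2
    · simpa using hu
    rwa [Equiv.swap_apply_of_ne_of_ne h1 h2]
  refine Finset.card_bij (fun e _ => (Equiv.swap u v).trans e) ?_ ?_ ?_
  · intro e he
    simp only [Finset.mem_filter, Finset.mem_univ, true_and] at he ⊢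
    refine ⟨hv, fun z hz => ?_⟩
    simpa using he.2 _ (hswap z hz)
  · intro e _ e' _ h
    have h' := congrArg (fun t => (Equiv.swap u v).trans t) h
    simpa [← Equiv.trans_assoc] using h'
  · intro e he
    simp only [Finset.mem_filter, Finset.mem_univ, true_and] at he
    refine ⟨(Equiv.swap u v).trans e, ?_, ?_⟩
    · simp only [Finset.mem_filter, Finset.mem_univ, true_and]
      refine ⟨hu, fun z hz => ?_⟩
      simpa using he.2 _ (hswap z hz)
    · simp [← Equiv.trans_assoc]

open scoped Classical in
theorem card_mul_card_isFirst {U : Finset Z} {u : Z} (hu : u ∈ U) :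
    U.card * (Finset.univ.filter (fun e : Z ≃ Fin (Fintype.card Z) => IsFirst e U u)).card =
      Fintype.card (Z ≃ Fin (Fintype.card Z)) := by
  have h1 : (Finset.univ : Finset (Z ≃ Fin (Fintype.card Z))) =
      U.biUnion (fun v => Finset.univ.filter (fun e => IsFirst e U v)) := by
    ext e
    simp only [Finset.mem_univ, Finset.mem_biUnion, Finset.mem_filter, true_and, true_iff]
    obtain ⟨v, hv⟩ := exists_isFirst e ⟨u, hu⟩
    exact ⟨v, hv.1, hv⟩
  refine Eq.trans ?_ (congrArg Finset.card h1).symm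
  rw [Finset.card_biUnion]
  · rw [Finset.sum_congr rfl (fun v hv => card_isFirst_eq hv hu)]
    simp
  · intro v _ w _ hvw
    rw [Function.onFun, Finset.disjoint_left]
    intro e he he'
    simp only [Finset.mem_filter, Finset.mem_univ, true_and] at he he'
    exact hvw (he.unique he')

open scoped Classical in
-- If the first element of `N ∪ N'` lies in `N ∩ N'`, it is first in both sets. It is uniformly
-- distributed on the union, so failure has probability at most the proportion of the symmetric
-- difference, which is at most `2 * ε`.
theorem card_not_common_first_le {N N' : Finset Z} {ε : ℝ} (hε : 0 ≤ ε) (hN : N.Nonempty)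
    (hcard : N'.card = N.card) (hint : (1 - ε) * N.card ≤ (N ∩ N').card) :
    ((Finset.univ.filter (fun e : Z ≃ Fin (Fintype.card Z) =>
      ¬ ∃ z, IsFirst e N z ∧ IsFirst e N' z)).card : ℝ) ≤
      2 * ε * Fintype.card (Z ≃ Fin (Fintype.card Z)) := by
  set U := N ∪ N'
  set W := U \ (N ∩ N')
  obtain ⟨n, hn⟩ := hN
  have hnU : n ∈ U := Finset.mem_union_left _ hn
  set c := (Finset.univ.filter (fun e : Z ≃ Fin (Fintype.card Z) => IsFirst e U n)).card
  have hc : U.card * c = Fintype.card (Z ≃ Fin (Fintype.card Z)) := card_mul_card_isFirst hnU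
  have hsub : Finset.univ.filter (fun e : Z ≃ Fin (Fintype.card Z) =>
      ¬ ∃ z, IsFirst e N z ∧ IsFirst e N' z) ⊆
      W.biUnion (fun v => Finset.univ.filter (fun e => IsFirst e U v)) := by
    intro e he
    simp only [Finset.mem_filter, Finset.mem_univ, true_and, Finset.mem_biUnion] at he ⊢
    obtain ⟨v, hv⟩ := exists_isFirst e ⟨n, hnU⟩
    refine ⟨v, ?_, hv⟩
    refine Finset.mem_sdiff.2 ⟨hv.1, fun h => he ⟨v, ?_, ?_⟩⟩
    · exact ⟨(Finset.mem_inter.1 h).1, fun w hw => hv.2 w (Finset.mem_union_left _ hw)⟩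
    · exact ⟨(Finset.mem_inter.1 h).2, fun w hw => hv.2 w (Finset.mem_union_right _ hw)⟩
  have h1 := (Finset.card_le_card hsub).trans Finset.card_biUnion_le
  have h2 : ∑ v ∈ W, (Finset.univ.filter
      (fun e : Z ≃ Fin (Fintype.card Z) => IsFirst e U v)).card = W.card * c := by
    rw [Finset.sum_congr rfl (fun v hv => card_isFirst_eq (Finset.mem_sdiff.1 hv).1 hnU)]
    rw [Finset.sum_const, smul_eq_mul]
  rw [h2] at h1
  have h3 : U.card + (N ∩ N').card = N.card + N'.card := Finset.card_union_add_card_inter N N'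
  have h4 : W.card + (N ∩ N').card = U.card := by
    have : N ∩ N' ⊆ U := fun x hx => Finset.mem_union_left _ (Finset.mem_inter.1 hx).1
    rw [Finset.card_sdiff_of_subset this]
    have := Finset.card_le_card this
    omega
  have h5 : N.card ≤ U.card := Finset.card_le_card Finset.subset_union_left
  have h3' : (U.card : ℝ) + (N ∩ N').card = N.card + N.card := by
    rw [hcard] at h3; exact_mod_cast h3
  have h4' : (W.card : ℝ) + (N ∩ N').card = U.card := by exact_mod_cast h4
  have h5' : (N.card : ℝ) ≤ U.card := by exact_mod_cast h5
  have h6 : (W.card : ℝ) ≤ 2 * ε * U.card := by nlinarith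
  calc _ ≤ ((W.card * c : ℕ) : ℝ) := by exact_mod_cast h1
    _ = W.card * (c : ℝ) := by push_cast; ring
    _ ≤ 2 * ε * U.card * c := by gcongr
    _ = 2 * ε * ((U.card * c : ℕ) : ℝ) := by push_cast; ring
    _ = _ := by rw [hc]

end RandomOrder

/-! ### Almost equivariant sections of maps onto finite sets. -/

section Section

theorem card_filter_val_lt_eq_sum {Q : Type*} [Fintype Q] [DecidableEq Q] {n : ℕ} (f : Q → ℕ)
    (hf : ∀ c, f c ≤ n) :
    (Finset.univ.filter (fun z : Q × Fin n => (z.2 : ℕ) < f z.1)).card = ∑ c, f c := by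
  rw [Finset.card_eq_sum_card_fiberwise (f := Prod.fst) (t := Finset.univ)
    (fun z _ => Finset.mem_univ z.1)]
  refine Finset.sum_congr rfl (fun c _ => ?_)
  have : (Finset.univ.filter (fun z : Q × Fin n => (z.2 : ℕ) < f z.1)).filter
      (fun z => z.1 = c) =
      (Finset.univ.filter (fun i : Fin n => (i : ℕ) < f c)).image (Prod.mk c) := by
    ext ⟨a, i⟩
    simp only [Finset.mem_filter, Finset.mem_univ, true_and, Finset.mem_image, Prod.mk.injEq]
    constructor
    · rintro ⟨h, rfl⟩
      exact ⟨i, h, rfl, rfl⟩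
    · rintro ⟨j, h, rfl, rfl⟩
      exact ⟨h, rfl⟩
  rw [this, Finset.card_image_of_injective _ (Prod.mk_right_injective c), Fin.card_filter_val_lt]
  exact min_eq_right (hf c)

variable {Γ Q : Type*} [Group Γ] [MulAction Γ Q] [Fintype Q] [DecidableEq Q]

/-- The number of ways to write `q = x • c` with `x ∈ X`. -/
def visitCount (X : Finset Γ) (q c : Q) : ℕ := (X.filter (fun x => x⁻¹ • q = c)).card

/-- The multiset of points `x⁻¹ • q`, `x ∈ X`, with multiplicities recorded by labels. -/
def visitSet (X : Finset Γ) (q : Q) : Finset (Q × Fin X.card) :=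
  Finset.univ.filter (fun z => (z.2 : ℕ) < visitCount X q z.1)

theorem card_visitSet (X : Finset Γ) (q : Q) : (visitSet X q).card = X.card := by
  rw [visitSet, card_filter_val_lt_eq_sum (visitCount X q) (fun c => Finset.card_filter_le _ _)]
  exact (Finset.card_eq_sum_card_fiberwise (fun x _ => Finset.mem_univ (x⁻¹ • q))).symm

variable [DecidableEq Γ]

/-- If `x` and `s * x` are in `X`, then `x⁻¹ • q = (s * x)⁻¹ • (s • q)` is visited from both points.
The labels turn the minimum of two multiplicities into the size of an intersection of sets. -/
theorem le_card_visitSet_inter (X : Finset Γ) (s : Γ) (q : Q) :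
    (X.filter (fun x => s * x ∈ X)).card ≤ (visitSet X q ∩ visitSet X (s • q)).card := by
  have h1 : visitSet X q ∩ visitSet X (s • q) = Finset.univ.filter (fun z : Q × Fin X.card =>
      (z.2 : ℕ) < min (visitCount X q z.1) (visitCount X (s • q) z.1)) := by
    ext z
    simp [visitSet]
  rw [h1, card_filter_val_lt_eq_sum (fun c => min (visitCount X q c) (visitCount X (s • q) c))
    (fun c => (min_le_left _ _).trans (Finset.card_filter_le _ _)),
    Finset.card_eq_sum_card_fiberwise (fun x _ => Finset.mem_univ (x⁻¹ • q))]
  refine Finset.sum_le_sum (fun c _ => le_min ?_ ?_)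
  · refine Finset.card_le_card (fun x hx => ?_)
    simp only [Finset.mem_filter] at hx ⊢
    exact ⟨hx.1.1, hx.2⟩
  · refine Finset.card_le_card_of_injOn (fun x => s * x) ?_ (fun x _ y _ h => by simpa using h)
    intro x hx
    simp only [Finset.coe_filter, Set.mem_ofPred_eq, Finset.mem_filter] at hx ⊢
    refine ⟨hx.1.2, ?_⟩
    rw [← hx.2, mul_inv_rev, mul_smul, inv_smul_smul]

open scoped Classical in
/-- An equivariant surjection onto a finite `Γ`-set has a section that is equivariant at most points,
away from the points where some short element of `Γ` fixes the point but not its lifts. -/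
theorem exists_almost_equivariant_section {Y : Type*} [MulAction Γ Y] (π : Y → Q)
    (hπ : Function.Surjective π) (hequiv : ∀ (γ : Γ) (y : Y), π (γ • y) = γ • π y)
    (X S : Finset Γ) (hX : X.Nonempty) {ε : ℝ} (hε : 0 ≤ ε)
    (hinv : ∀ s ∈ S, ((X.filter (fun x => s * x ∉ X)).card : ℝ) ≤ ε * X.card) :
    ∃ σ : Q → Y, (∀ q, π (σ q) = q) ∧ ∀ s ∈ S,
      ((Finset.univ.filter (fun q => σ (s • q) ≠ s • σ q)).card : ℝ) ≤
        2 * ε * S.card * Fintype.card Q +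
        (Finset.univ.filter (fun q : Q => ∃ x ∈ X, ∃ x' ∈ X, (s⁻¹ * x' * x⁻¹) • q = q ∧
          ∃ y, π y = q ∧ (s⁻¹ * x' * x⁻¹) • y ≠ y)).card := by
  set Z := Q × Fin X.card
  set Ord := Z ≃ Fin (Fintype.card Z)
  have hne : ∀ q : Q, (visitSet X q).Nonempty := fun q => by
    rw [← Finset.card_pos, card_visitSet]; exact hX.card_pos
  let sep : Ord → Γ → Q → Prop := fun e s q =>
    ¬ ∃ z, IsFirst e (visitSet X q) z ∧ IsFirst e (visitSet X (s • q)) z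
  have hOrd : Nonempty Ord := ⟨Fintype.equivFin Z⟩
  -- Some order does at least as well as the average over all orders, simultaneously for the sum
  -- over `S`.
  obtain ⟨e, he⟩ : ∃ e : Ord, ∑ s ∈ S, ((Finset.univ.filter (fun q => sep e s q)).card : ℝ) ≤
      2 * ε * S.card * Fintype.card Q := by
    by_contra! hcon
    have h1 : ∑ _e : Ord, 2 * ε * S.card * Fintype.card Q <
        ∑ e : Ord, ∑ s ∈ S, ((Finset.univ.filter (fun q => sep e s q)).card : ℝ) :=
      Finset.sum_lt_sum_of_nonempty Finset.univ_nonempty (fun e _ => hcon e)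
    have h2 : ∑ e : Ord, ∑ s ∈ S, ((Finset.univ.filter (fun q => sep e s q)).card : ℝ) =
        ∑ s ∈ S, ∑ q : Q, ((Finset.univ.filter (fun e : Ord => sep e s q)).card : ℝ) := by
      rw [Finset.sum_comm]
      refine Finset.sum_congr rfl (fun s _ => ?_)
      simp only [Finset.card_filter, Nat.cast_sum]
      exact Finset.sum_comm
    have h3 : ∑ s ∈ S, ∑ q : Q, ((Finset.univ.filter (fun e : Ord => sep e s q)).card : ℝ) ≤
        ∑ _s ∈ S, ∑ _q : Q, 2 * ε * Fintype.card Ord := by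
      refine Finset.sum_le_sum (fun s hs => Finset.sum_le_sum (fun q _ => ?_))
      refine card_not_common_first_le (N := visitSet X q) (N' := visitSet X (s • q)) hε (hne q)
        (by rw [card_visitSet, card_visitSet]) ?_
      have h4 := le_card_visitSet_inter X s q
      have h5 : (X.filter (fun x => s * x ∈ X)).card + (X.filter (fun x => s * x ∉ X)).card =
        X.card := Finset.card_filter_add_card_filter_not (s := X) _
      have h6 := hinv s hs
      rw [card_visitSet]
      have h4' : ((X.filter (fun x => s * x ∈ X)).card : ℝ) ≤
        ((visitSet X q ∩ visitSet X (s • q)).card : ℝ) := by exact_mod_cast h4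
      have h5' : ((X.filter (fun x => s * x ∈ X)).card : ℝ) +
        (X.filter (fun x => s * x ∉ X)).card = X.card := by exact_mod_cast h5
      linarith
    rw [h2] at h1
    have h4 := h1.trans_le h3
    simp only [Finset.sum_const, nsmul_eq_mul, Finset.card_univ] at h4
    exact absurd h4 (not_lt.2 (le_of_eq (by ring)))
  choose first hfirst using fun q => exists_isFirst e (hne q)
  have hx : ∀ q, ∃ x ∈ X, x⁻¹ • q = (first q).1 := by
    intro q
    have h := (hfirst q).1
    simp only [visitSet, Finset.mem_filter, Finset.mem_univ, true_and] at h
    obtain ⟨x, hx⟩ := Finset.card_pos.1 (Nat.zero_lt_of_lt h)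
    exact ⟨x, (Finset.mem_filter.1 hx).1, (Finset.mem_filter.1 hx).2⟩
  choose x hxX hx using hx
  choose lift hlift using hπ
  refine ⟨fun q => x q • lift (first q).1, fun q => ?_, fun s hs => ?_⟩
  · rw [hequiv, hlift, ← hx, smul_inv_smul]
  · set B := Finset.univ.filter (fun q : Q => ∃ x ∈ X, ∃ x' ∈ X, (s⁻¹ * x' * x⁻¹) • q = q ∧
          ∃ y, π y = q ∧ (s⁻¹ * x' * x⁻¹) • y ≠ y)
    have hsub : Finset.univ.filter (fun q => x (s • q) • lift (first (s • q)).1 ≠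
        s • x q • lift (first q).1) ⊆ Finset.univ.filter (fun q => sep e s q) ∪ B := by
      intro q hq
      simp only [Finset.mem_filter, Finset.mem_univ, true_and] at hq
      by_contra hcon
      simp only [Finset.mem_union, Finset.mem_filter, Finset.mem_univ, true_and, not_or, sep, B,
        not_not] at hcon
      obtain ⟨⟨z, hz1, hz2⟩, hB⟩ := hcon
      have e1 : first q = z := (hfirst q).unique hz1
      have e2 : first (s • q) = z := (hfirst _).unique hz2
      push Not at hB
      -- When `q` and `s • q` select the same point, the two ways of returning to `q` differ by a
      -- short element fixing `q`. Off `B` it also fixes the lift `σ q`, which is the wanted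
      -- equivariance.
      have hfix : (s⁻¹ * x (s • q) * (x q)⁻¹) • q = q := by
        rw [mul_smul, hx q, e1, mul_smul, ← e2, ← hx (s • q), smul_inv_smul, inv_smul_smul]
      have hy := hB (x q) (hxX q) (x (s • q)) (hxX _) hfix (x q • lift (first q).1)
        (by rw [hequiv, hlift, ← hx, smul_inv_smul])
      rw [mul_smul, inv_smul_smul, mul_smul, inv_smul_eq_iff] at hy
      apply hq
      rw [← hy, e1, e2]
    have h1 : ((Finset.univ.filter (fun q => x (s • q) • lift (first (s • q)).1 ≠
        s • x q • lift (first q).1)).card : ℝ) ≤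
        (Finset.univ.filter (fun q => sep e s q)).card + B.card := by
      exact_mod_cast (Finset.card_le_card hsub).trans (Finset.card_union_le _ _)
    have h2 : ((Finset.univ.filter (fun q => sep e s q)).card : ℝ) ≤
        ∑ s ∈ S, ((Finset.univ.filter (fun q => sep e s q)).card : ℝ) :=
      Finset.single_le_sum (f := fun s => ((Finset.univ.filter (fun q => sep e s q)).card : ℝ))
        (fun _ _ => Nat.cast_nonneg _) hs
    linarith

end Section

/-! ### Scarcity of points of the quotient with spurious stabilizers. -/

section Separation

variable {G : Type*} [Group G] {L : ℕ → Subgroup G}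

theorem IsSeparatingNestedSeq.eventually_sepMod (hL : IsSeparatingNestedSeq L) (F : Finset G) :
    ∀ᶠ j in Filter.atTop, SepMod (L j) F := by
  have h : ∀ x ∈ F, ∀ y ∈ F, ∀ᶠ j in Filter.atTop, (x : G ⧸ L j) = y → x = y := by
    intro x _ y _
    by_cases hxy : x = y
    · exact Filter.Eventually.of_forall (fun _ _ => hxy)
    · obtain ⟨n, hn⟩ := hL.separating (x⁻¹ * y) (fun h => hxy (inv_mul_eq_one.1 h))
      filter_upwards [Filter.eventually_ge_atTop n] with j hj h
      exact absurd (hL.nested hj (QuotientGroup.eq.1 h)) hn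
  simp only [SepMod]
  rw [Filter.eventually_all_finset]
  intro x hx
  rw [Filter.eventually_all_finset]
  exact h x hx

/-- For `γ = (a, b)`, fixing `q` means that `q` conjugates `b` to `a` in the quotient. If `a` has
finitely many conjugates, far quotients separate them and `b`, so the relation already holds in `G`
and there are no bad points. Otherwise take `r > 1 / η` conjugates separated by the quotient:
translating `B` accordingly gives `r` disjoint sets of the same size. -/
theorem IsSeparatingNestedSeq.eventually_card_bad_le (hL : IsSeparatingNestedSeq L) (γ : G × G)
    {η : ℝ} (hη : 0 < η) :
    ∀ᶠ j in Filter.atTop, ∀ [(L j).Normal] (B : Finset (G ⧸ L j)),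
      (∀ q ∈ B, γ • q = q ∧ ∃ y : G, (y : G ⧸ L j) = q ∧ γ • y ≠ y) →
        (B.card : ℝ) ≤ η * (L j).index := by
  classical
  obtain ⟨a, b⟩ := γ
  by_cases hfin : (Set.range (fun y : G => y⁻¹ * a * y)).Finite
  · filter_upwards [hL.eventually_sepMod (insert b hfin.toFinset)] with j hj _ B hB
    have : B = ∅ := by
      refine Finset.eq_empty_of_forall_notMem (fun q hq => ?_)
      obtain ⟨h1, y, rfl, hy⟩ := hB q hq
      refine hy ?_
      have h2 : ((y⁻¹ * a * y : G) : G ⧸ L j) = b := by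
        have h3 : (a : G ⧸ L j) * (y : G ⧸ L j) * (b : G ⧸ L j)⁻¹ = y := h1
        rw [mul_inv_eq_iff_eq_mul] at h3
        rw [mul_assoc, QuotientGroup.mk_mul, QuotientGroup.mk_mul, h3, QuotientGroup.mk_inv,
          inv_mul_cancel_left]
      have h4 := hj _ (Finset.mem_insert_of_mem (hfin.mem_toFinset.2 ⟨y, rfl⟩)) b
        (Finset.mem_insert_self _ _) h2
      rw [twoSided_smul_def]
      simp only at h4 ⊢
      rw [← h4]
      group
    rw [this]
    simp only [Finset.card_empty, Nat.cast_zero]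
    positivity
  · obtain ⟨r, hr⟩ := exists_nat_gt (1 / η)
    obtain ⟨F, hFsub, hFcard⟩ := Set.Infinite.exists_subset_card_eq hfin r
    filter_upwards [hL.eventually_sepMod F] with j hj _ B hB
    have := hL.finiteIndex j
    have : Fintype (G ⧸ L j) := (L j).fintypeQuotientOfFiniteIndex
    have hch : ∀ c ∈ F, ∃ y : G, y⁻¹ * a * y = c := fun c hc => hFsub hc
    choose! y hy using hch
    have hcard : (F ×ˢ B).card ≤ (Finset.univ : Finset (G ⧸ L j)).card := by
      refine Finset.card_le_card_of_injOn
        (fun p => ((y p.1 : G) : G ⧸ L j)⁻¹ * p.2) (by simp) ?_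
      rintro ⟨c, q⟩ hp ⟨c', q'⟩ hp' heq
      simp only [Finset.coe_product, Set.mem_prod, Finset.mem_coe] at hp hp' heq
      -- The translated point conjugates `b` to `c`, so it determines `c`: the translates of `B` are
      -- disjoint.
      have key : ∀ c ∈ F, ∀ q ∈ B, ((c : G) : G ⧸ L j) =
          (((y c : G) : G ⧸ L j)⁻¹ * q) * b * (((y c : G) : G ⧸ L j)⁻¹ * q)⁻¹ := by
        intro c hc q hq
        have h3 : (a : G ⧸ L j) * q * (b : G ⧸ L j)⁻¹ = q := (hB q hq).1
        rw [mul_inv_eq_iff_eq_mul] at h3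
        have h4 : (a : G ⧸ L j) = q * b * q⁻¹ := by rw [← h3, mul_inv_cancel_right]
        rw [← hy c hc, QuotientGroup.mk_mul, QuotientGroup.mk_mul, QuotientGroup.mk_inv, h4,
          hy c hc]
        group
      have hcc : c = c' := by
        refine hj c hp.1 c' hp'.1 ?_
        rw [key c hp.1 q hp.2, key c' hp'.1 q' hp'.2, heq]
      subst hcc
      rw [mul_right_inj] at heq
      rw [heq]
    rw [Finset.card_product, hFcard, Finset.card_univ, ← Nat.card_eq_fintype_card,
      ← Subgroup.index_eq_card] at hcard
    have h1 : (r : ℝ) * B.card ≤ (L j).index := by exact_mod_cast hcard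
    rw [div_lt_iff₀ hη] at hr
    have h2 : (0 : ℝ) ≤ B.card := Nat.cast_nonneg _
    nlinarith

end Separation

/-! ### Almost invariant transversals from amenability. -/

section Folner

variable {G : Type*} [Group G] [DecidableEq G]

theorem IsRightFolnerSeq.exists_left_invariant {F : ℕ → Finset G} (hF : IsRightFolnerSeq F)
    (S : Finset G) {ε : ℝ} (hε : 0 < ε) :
    ∃ A : Finset G, A.Nonempty ∧
      ∀ s ∈ S, ((A.filter (fun x => s * x ∉ A)).card : ℝ) ≤ ε * A.card := by
  have h : ∀ᶠ n in Filter.atTop, ∀ s ∈ S,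
      ((F n ∆ (F n).image (fun x => x * s)).card : ℝ) / ((F n).card : ℝ) < ε := by
    rw [Filter.eventually_all_finset]
    exact fun s _ => (hF.tendsto s).eventually_lt_const hε
  obtain ⟨n, hn⟩ := h.exists
  have hne : (F n).Nonempty := ⟨1, hF.mono (Nat.zero_le n) hF.one_mem⟩
  -- Inversion turns right invariance into left invariance.
  refine ⟨(F n).image (fun x => x⁻¹), hne.image _, fun s hs => ?_⟩
  have h1 := hn s hs
  have hpos : (0 : ℝ) < (F n).card := by exact_mod_cast hne.card_pos
  rw [div_lt_iff₀ hpos] at h1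
  rw [Finset.card_image_of_injective _ inv_injective]
  refine le_trans ?_ h1.le
  norm_cast
  refine Finset.card_le_card_of_injOn (fun x => x⁻¹) ?_ (fun x _ y _ h => by simpa using h)
  intro x hx
  simp only [Finset.coe_filter, Finset.mem_image, Set.mem_ofPred_eq, not_exists, not_and] at hx
  obtain ⟨⟨y, hy, rfl⟩, hx⟩ := hx
  simp only [Finset.mem_coe, inv_inv]
  refine Finset.mem_symmDiff.2 (Or.inl ⟨hy, fun h => ?_⟩)
  obtain ⟨z, hz, hzy⟩ := Finset.mem_image.1 h
  refine hx z hz ?_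
  rw [← hzy]
  group

/-- A countable amenable group has two-sided invariant transversals of all far subgroups of a
separating sequence. -/
theorem IsAmenableGroup.eventually_exists_invariant_transv (hG : IsAmenableGroup G)
    {L : ℕ → Subgroup G} (hL : IsSeparatingNestedSeq L) (S : Finset (G × G)) {ε : ℝ}
    (hε : 0 < ε) :
    ∀ᶠ j in Filter.atTop, ∃ R : Finset G, IsTransv (L j) R ∧
      ∀ γ ∈ S, (boundaryCard γ R : ℝ) ≤ ε * R.card := by
  classical
  obtain ⟨F, hF⟩ := hG
  -- `A ×ˢ A` is invariant up to `2 * ε₁`, so the random order costs at most `4 * ε₁ * S.card ≤ ε /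
  -- 2`.
  set ε₁ := ε / (8 * (S.card + 1))
  have hε₁ : 0 < ε₁ := by positivity
  obtain ⟨A, hA, hAinv⟩ := hF.exists_left_invariant (S.image Prod.fst ∪ S.image Prod.snd) hε₁
  set X := A ×ˢ A
  have hX : X.Nonempty := hA.product hA
  have hXinv : ∀ s ∈ S, ((X.filter (fun x => s * x ∉ X)).card : ℝ) ≤ (2 * ε₁) * X.card := by
    intro s hs
    have h1 := hAinv s.1 (Finset.mem_union_left _ (Finset.mem_image_of_mem _ hs))
    have h2 := hAinv s.2 (Finset.mem_union_right _ (Finset.mem_image_of_mem _ hs))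
    have hsub : X.filter (fun x => s * x ∉ X) ⊆
        (A.filter (fun x => s.1 * x ∉ A)) ×ˢ A ∪ A ×ˢ (A.filter (fun x => s.2 * x ∉ A)) := by
      rintro ⟨x, y⟩ hxy
      simp only [X, Finset.mem_filter, Finset.mem_product, Finset.mem_union, Prod.fst_mul,
        Prod.snd_mul] at hxy ⊢
      tauto
    have h3 := (Finset.card_le_card hsub).trans (Finset.card_union_le _ _)
    rw [Finset.card_product, Finset.card_product] at h3
    have h4 : ((X.filter (fun x => s * x ∉ X)).card : ℝ) ≤
        (A.filter (fun x => s.1 * x ∉ A)).card * A.card +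
          A.card * (A.filter (fun x => s.2 * x ∉ A)).card := by exact_mod_cast h3
    have h5 : (X.card : ℝ) = A.card * A.card := by
      simp [X, Finset.card_product]
    have h6 : (0 : ℝ) ≤ A.card := Nat.cast_nonneg _
    rw [h5]
    nlinarith
  set T := (S ×ˢ X ×ˢ X).image (fun p => p.1⁻¹ * p.2.2 * p.2.1⁻¹)
  -- For each `s` there are `X.card * X.card` pairs, so bad fixed points cost at most `ε / 4`.
  set η := ε / (4 * (X.card * X.card))
  have hXpos : (0 : ℝ) < X.card := by exact_mod_cast hX.card_pos
  have hη : 0 < η := by positivity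
  have hbad := (Filter.eventually_all_finset T).2
    (fun γ _ => hL.eventually_card_bad_le γ hη)
  filter_upwards [hbad] with j hj
  have := hL.normal j
  have := hL.finiteIndex j
  have : Fintype (G ⧸ L j) := (L j).fintypeQuotientOfFiniteIndex
  obtain ⟨σ, hσ, hσS⟩ := exists_almost_equivariant_section (Γ := G × G)
    (fun g : G => (g : G ⧸ L j)) QuotientGroup.mk_surjective
    (fun γ y => coe_twoSided_smul (L j) γ y) X S hX (by positivity : (0 : ℝ) ≤ 2 * ε₁) hXinv
  have hσinj : Function.Injective σ := fun q q' h => by rw [← hσ q, ← hσ q', h]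
  refine ⟨Finset.univ.image σ, ⟨?_, ?_⟩, ?_⟩
  · intro x hx y hy hxy
    obtain ⟨q, _, rfl⟩ := Finset.mem_image.1 hx
    obtain ⟨q', _, rfl⟩ := Finset.mem_image.1 hy
    have h : q = q' := by rw [← hσ q, ← hσ q']; exact hxy
    rw [h]
  · exact fun g => ⟨σ g, Finset.mem_image_of_mem _ (Finset.mem_univ _), hσ g⟩
  · intro s hs
    rw [Finset.card_image_of_injective _ hσinj, Finset.card_univ]
    set N : ℝ := (Fintype.card (G ⧸ L j) : ℝ)
    have hN : N = (L j).index := by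
      rw [Subgroup.index_eq_card, Nat.card_eq_fintype_card]
    have h1 : (boundaryCard s (Finset.univ.image σ) : ℝ) ≤
        (Finset.univ.filter (fun q => σ (s • q) ≠ s • σ q)).card := by
      norm_cast
      refine (Finset.card_le_card (t := (Finset.univ.filter
        (fun q => σ (s • q) ≠ s • σ q)).image σ) ?_).trans Finset.card_image_le
      intro x hx
      obtain ⟨hx1, hx2⟩ := Finset.mem_filter.1 hx
      obtain ⟨q, _, rfl⟩ := Finset.mem_image.1 hx1
      refine Finset.mem_image_of_mem _ (Finset.mem_filter.2 ⟨Finset.mem_univ _, fun h => hx2 ?_⟩)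
      rw [← h]
      exact Finset.mem_image_of_mem _ (Finset.mem_univ _)
    have h2 : ((Finset.univ.filter (fun q : G ⧸ L j => ∃ x ∈ X, ∃ x' ∈ X,
        (s⁻¹ * x' * x⁻¹) • q = q ∧ ∃ y : G, (y : G ⧸ L j) = q ∧
          (s⁻¹ * x' * x⁻¹) • y ≠ y)).card : ℝ) ≤ X.card * X.card * (η * N) := by
      have hsub : Finset.univ.filter (fun q : G ⧸ L j => ∃ x ∈ X, ∃ x' ∈ X,
          (s⁻¹ * x' * x⁻¹) • q = q ∧ ∃ y : G, (y : G ⧸ L j) = q ∧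
          (s⁻¹ * x' * x⁻¹) • y ≠ y) ⊆ (X ×ˢ X).biUnion (fun p => Finset.univ.filter (fun q =>
            (s⁻¹ * p.2 * p.1⁻¹) • q = q ∧ ∃ y : G, (y : G ⧸ L j) = q ∧
              (s⁻¹ * p.2 * p.1⁻¹) • y ≠ y)) := by
        intro q hq
        obtain ⟨x, hx, x', hx', h⟩ := (Finset.mem_filter.1 hq).2
        exact Finset.mem_biUnion.2 ⟨(x, x'), Finset.mk_mem_product hx hx',
          Finset.mem_filter.2 ⟨Finset.mem_univ _, h⟩⟩
      have h3 := (Finset.card_le_card hsub).trans Finset.card_biUnion_le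
      refine (Nat.cast_le.2 h3).trans ?_
      push_cast
      refine (Finset.sum_le_sum (g := fun _ => η * N) (fun p hp => ?_)).trans_eq ?_
      · rw [hN]
        obtain ⟨hp1, hp2⟩ := Finset.mem_product.1 hp
        refine hj (s⁻¹ * p.2 * p.1⁻¹) (Finset.mem_image.2 ⟨(s, p.1, p.2), ?_, rfl⟩) _ ?_
        · exact Finset.mk_mem_product hs (Finset.mk_mem_product hp1 hp2)
        · exact fun q hq => (Finset.mem_filter.1 hq).2
      · rw [Finset.sum_const, Finset.card_product, nsmul_eq_mul]
        push_cast
        rfl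
    have h4 := h1.trans (le_trans (le_of_eq (by congr!)) ((hσS s hs).trans
      (add_le_add le_rfl (le_trans (le_of_eq (by congr!)) h2))))
    have h5 : (X.card : ℝ) * X.card * (η * N) = ε / 4 * N := by
      simp only [η]; field_simp
    have hN0 : 0 ≤ N := Nat.cast_nonneg _
    have h6 : 2 * (2 * ε₁) * S.card * N ≤ ε / 2 * N := by
      refine mul_le_mul_of_nonneg_right ?_ hN0
      simp only [ε₁]
      rw [show 2 * (2 * (ε / (8 * ((S.card : ℝ) + 1)))) * S.card =
        (ε / 2) * (S.card / ((S.card : ℝ) + 1)) by field_simp; ring]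
      have : (S.card : ℝ) / ((S.card : ℝ) + 1) ≤ 1 := by
        rw [div_le_one (by positivity)]; linarith
      nlinarith
    have h7 : 0 ≤ ε * N := mul_nonneg hε.le hN0
    linarith

end Folner

/-! ### A single weighted measure of all two-sided boundaries. -/

section Defect

variable {G : Type*}

/-- Positive summable weights of total mass at most one. -/
structure IsWeight (w : G × G → ℝ) : Prop where
  pos : ∀ γ, 0 < w γ
  summable : Summable w
  tsum_le : ∑' γ, w γ ≤ 1

theorem exists_isWeight [Countable G] : ∃ w : G × G → ℝ, IsWeight w := by
  have : Encodable (G × G) := Encodable.ofCountable _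
  obtain ⟨w, hpos, c, hc, hc1⟩ := posSumOfEncodable (ε := 1) one_pos (G × G)
  exact ⟨w, hpos, hc.summable, hc.tsum_eq ▸ hc1⟩

variable {w : G × G → ℝ}

theorem IsWeight.tsum_mul_le (hw : IsWeight w) {c : ℝ} (hc : 0 ≤ c) : ∑' γ, w γ * c ≤ c := by
  rw [tsum_mul_right]
  exact mul_le_of_le_one_left hc hw.tsum_le

variable [Group G] [DecidableEq G]

/-- The weighted boundary of a finite set under the two-sided action. -/
noncomputable def defect (w : G × G → ℝ) (K : Finset G) : ℝ :=
  ∑' γ, w γ * boundaryCard γ K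

theorem IsWeight.summable_defect (hw : IsWeight w) (K : Finset G) :
    Summable (fun γ => w γ * (boundaryCard γ K : ℝ)) := by
  refine Summable.of_nonneg_of_le (fun γ => mul_nonneg (hw.pos γ).le (Nat.cast_nonneg _))
    (fun γ => ?_) (hw.summable.mul_right (K.card : ℝ))
  exact mul_le_mul_of_nonneg_left (by exact_mod_cast boundaryCard_le_card γ K) (hw.pos γ).le

theorem IsWeight.defect_nonneg (hw : IsWeight w) (K : Finset G) : 0 ≤ defect w K :=
  tsum_nonneg (fun γ => mul_nonneg (hw.pos γ).le (Nat.cast_nonneg _))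

theorem IsWeight.defect_le_card (hw : IsWeight w) (K : Finset G) : defect w K ≤ K.card := by
  refine ((hw.summable_defect K).tsum_le_tsum (fun γ => ?_)
    (hw.summable.mul_right (K.card : ℝ))).trans (hw.tsum_mul_le (Nat.cast_nonneg _))
  exact mul_le_mul_of_nonneg_left (by exact_mod_cast boundaryCard_le_card γ K) (hw.pos γ).le

theorem IsWeight.mul_boundaryCard_le (hw : IsWeight w) (γ : G × G) (K : Finset G) :
    w γ * boundaryCard γ K ≤ defect w K :=
  (hw.summable_defect K).le_tsum γ (fun η _ => mul_nonneg (hw.pos η).le (Nat.cast_nonneg _))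

theorem IsWeight.defect_extendMod_le (hw : IsWeight w) (M : Subgroup G) [M.Normal] (E : Finset G)
    {R : Finset G} (hR : SepMod M R) :
    defect w (extendMod M E R) ≤ 2 * defect w E + defect w R := by
  have hE := (hw.summable_defect E).mul_left 2
  rw [defect, defect, defect, ← tsum_mul_left, ← hE.tsum_add (hw.summable_defect R)]
  refine (hw.summable_defect _).tsum_le_tsum (fun γ => ?_) (hE.add (hw.summable_defect R))
  have h : (boundaryCard γ (extendMod M E R) : ℝ) ≤ 2 * boundaryCard γ E + boundaryCard γ R := by
    exact_mod_cast boundaryCard_extendMod_le γ M E hR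
  nlinarith [hw.pos γ]

theorem IsWeight.defect_le_of_card_eq (hw : IsWeight w) {K K' : Finset G}
    (h : K'.card = K.card) : defect w K' ≤ defect w K + 2 * (K' \ K).card := by
  have hs := hw.summable.mul_right (2 * ((K' \ K).card : ℝ))
  refine le_trans ?_ (add_le_add_right (hw.tsum_mul_le (by positivity)) _)
  rw [defect, defect, ← (hw.summable_defect K).tsum_add hs]
  refine (hw.summable_defect _).tsum_le_tsum (fun γ => ?_) ((hw.summable_defect K).add hs)
  have h : (boundaryCard γ K' : ℝ) ≤ boundaryCard γ K + 2 * (K' \ K).card := by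
    exact_mod_cast boundaryCard_le_of_card_eq γ h
  nlinarith [hw.pos γ]

/-- A finite set of pairs carries all but `ε / 2` of the weight; on the rest the boundary is at most
the whole set. -/
theorem IsAmenableGroup.eventually_exists_defect_le (hG : IsAmenableGroup G)
    {L : ℕ → Subgroup G} (hL : IsSeparatingNestedSeq L) (hw : IsWeight w) {ε : ℝ} (hε : 0 < ε) :
    ∀ᶠ j in Filter.atTop, ∃ R : Finset G, IsTransv (L j) R ∧ defect w R ≤ ε * R.card := by
  have htail : ∀ᶠ S : Finset (G × G) in Filter.atTop, ∑' γ, w γ - ∑ γ ∈ S, w γ < ε / 2 := by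
    have h := (tendsto_const_nhds (x := ∑' γ, w γ)).sub hw.summable.hasSum
    rw [sub_self] at h
    exact h.eventually_lt_const (half_pos hε)
  obtain ⟨S, hS⟩ := htail.exists
  filter_upwards [hG.eventually_exists_invariant_transv hL S (half_pos hε)] with j hj
  obtain ⟨R, hR, hRS⟩ := hj
  refine ⟨R, hR, ?_⟩
  have hR0 : (0 : ℝ) ≤ R.card := Nat.cast_nonneg _
  have hle : ∀ γ, (boundaryCard γ R : ℝ) ≤ R.card := fun γ => by
    exact_mod_cast boundaryCard_le_card γ R
  have h1 := (hw.summable_defect R).sum_add_tsum_compl (s := S)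
  have h2 := hw.summable.sum_add_tsum_compl (s := S)
  have h3 : ∑ γ ∈ S, w γ * (boundaryCard γ R : ℝ) ≤ ε / 2 * R.card := by
    have hS1 : ∑ γ ∈ S, w γ ≤ 1 :=
      (hw.summable.sum_le_tsum S (fun γ _ => (hw.pos γ).le)).trans hw.tsum_le
    calc ∑ γ ∈ S, w γ * (boundaryCard γ R : ℝ) ≤ ∑ γ ∈ S, w γ * (ε / 2 * R.card) :=
          Finset.sum_le_sum (fun γ hγ => mul_le_mul_of_nonneg_left (hRS γ hγ) (hw.pos γ).le)
      _ = (∑ γ ∈ S, w γ) * (ε / 2 * R.card) := by rw [Finset.sum_mul]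
      _ ≤ 1 * (ε / 2 * R.card) := by gcongr
      _ = _ := one_mul _
  have h4 : ∑' γ : ↥((S : Set (G × G))ᶜ), w γ * (boundaryCard γ.1 R : ℝ) ≤
      (∑' γ : ↥((S : Set (G × G))ᶜ), w γ) * R.card := by
    rw [← tsum_mul_right]
    refine Summable.tsum_le_tsum (fun γ => mul_le_mul_of_nonneg_left (hle _) (hw.pos _).le)
      ((hw.summable_defect R).subtype _) ((hw.summable.mul_right _).subtype _)
  rw [defect, ← h1]
  nlinarith

end Defect

/-! ### Concatenating chains, and a contraction estimate. -/

section Chain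

/-- Concatenation of finite chains. -/
theorem exists_concat {α : Type*} (Inv : ℕ → ℕ → α → Prop) (Rel : ℕ → ℕ → α → α → Prop)
    (Link : ℕ → α → α → Prop)
    (hstep : ∀ k p K, Inv k p K → ∃ (c : ℕ → α) (m : ℕ), p < m ∧ c p = K ∧
      (∀ j, p ≤ j → j < m → Rel k j (c j) (c (j + 1))) ∧ Inv (k + 1) m (c m) ∧ Link k K (c m))
    {p₀ : ℕ} {K₀ : α} (h₀ : Inv 0 p₀ K₀) :
    ∃ (c : ℕ → α) (n : ℕ → ℕ), n 0 = p₀ ∧ c p₀ = K₀ ∧ StrictMono n ∧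
      (∀ k j, n k ≤ j → j < n (k + 1) → Rel k j (c j) (c (j + 1))) ∧
      (∀ k, Inv k (n k) (c (n k))) ∧ ∀ k, Link k (c (n k)) (c (n (k + 1))) := by
  choose! C m hpm hCp hrel hinv hlink using hstep
  let st : ℕ → ℕ × α := fun k => Nat.rec (p₀, K₀) (fun k s => (m k s.1 s.2, C k s.1 s.2 (m k s.1 s.2))) k
  have hst : ∀ k, st (k + 1) = (m k (st k).1 (st k).2,
      C k (st k).1 (st k).2 (m k (st k).1 (st k).2)) := fun k => rfl
  have hI : ∀ k, Inv k (st k).1 (st k).2 := by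
    intro k
    induction k with
    | zero => exact h₀
    | succ k ih => rw [hst]; exact hinv k _ _ ih
  set n : ℕ → ℕ := fun k => (st k).1
  have hn : StrictMono n := strictMono_nat_of_lt_succ (fun k => by
    change (st k).1 < (st (k + 1)).1
    rw [hst]; exact hpm k _ _ (hI k))
  have hidx : ∀ k j, n k ≤ j → j < n (k + 1) →
      Nat.findGreatest (fun i => n i ≤ j) j = k := by
    intro k j h1 h2
    rw [Nat.findGreatest_eq_iff]
    refine ⟨(hn.id_le k).trans h1, fun _ => h1, fun i hki _ hi => ?_⟩
    exact absurd (hi.trans_lt h2) (not_lt.2 (hn.monotone hki))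
  let c : ℕ → α := fun j =>
    C (Nat.findGreatest (fun i => n i ≤ j) j) (st (Nat.findGreatest (fun i => n i ≤ j) j)).1
      (st (Nat.findGreatest (fun i => n i ≤ j) j)).2 j
  have hc : ∀ k j, n k ≤ j → j < n (k + 1) → c j = C k (st k).1 (st k).2 j := by
    intro k j h1 h2
    simp only [c, hidx k j h1 h2]
  have hcn : ∀ k, c (n k) = (st k).2 := fun k => by
    rw [hc k (n k) le_rfl (hn k.lt_succ_self)]
    exact hCp k _ _ (hI k)
  -- At the endpoint `n (k + 1)` the value of `c` is taken from the next chain, which starts where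
  -- this one ends.
  have hcm : ∀ k j, n k ≤ j → j ≤ n (k + 1) → c j = C k (st k).1 (st k).2 j := by
    intro k j h1 h2
    rcases h2.lt_or_eq with h2 | rfl
    · exact hc k j h1 h2
    · rw [hcn (k + 1), hst]
  refine ⟨c, n, rfl, hcn 0, hn, fun k j h1 h2 => ?_, fun k => ?_, fun k => ?_⟩
  · rw [hcm k j h1 h2.le, hcm k (j + 1) (by omega) h2]
    refine hrel k _ _ (hI k) j h1 ?_
    have : n (k + 1) = m k (st k).1 (st k).2 := congrArg Prod.fst (hst k)
    rwa [← this]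
  · rw [hcn]; exact hI k
  · rw [hcn k, hcn (k + 1), hst]
    exact hlink k _ _ (hI k)

end Chain

theorem StrictMono.exists_mem_interval {n : ℕ → ℕ} (hn : StrictMono n) {j : ℕ} (hj : n 0 ≤ j) :
    ∃ k, n k ≤ j ∧ j < n (k + 1) := by
  refine ⟨Nat.findGreatest (fun i => n i ≤ j) j, ?_, ?_⟩
  · exact Nat.findGreatest_spec (P := fun i => n i ≤ j) (Nat.zero_le j) hj
  · by_contra! h
    have := Nat.le_findGreatest (P := fun i => n i ≤ j) (hn.le_apply.trans h) h
    exact absurd this (Nat.not_succ_le_self _)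

theorem eventually_le_of_half_step {a b : ℕ → ℝ} (hb : Filter.Tendsto b Filter.atTop (𝓝 0))
    (hab : ∀ k, a (k + 1) ≤ a k / 2 + b k) {τ : ℝ} (hτ : 0 < τ) :
    ∀ᶠ k in Filter.atTop, a k ≤ τ := by
  obtain ⟨k₀, hk₀⟩ := Filter.eventually_atTop.1
    (hb.eventually_le_const (show (0 : ℝ) < τ / 4 by positivity))
  have h1 : ∀ i, a (k₀ + i) ≤ |a k₀| * (1 / 2) ^ i + τ / 2 := by
    intro i
    induction i with
    | zero => simp only [add_zero, pow_zero, mul_one]; linarith [le_abs_self (a k₀)]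
    | succ i ih =>
      have h2 := hab (k₀ + i)
      have h3 := hk₀ (k₀ + i) (by omega)
      rw [pow_succ, ← add_assoc]
      linarith
  have h2 : Filter.Tendsto (fun i : ℕ => |a k₀| * (1 / 2 : ℝ) ^ i + τ / 2) Filter.atTop
      (𝓝 (|a k₀| * 0 + τ / 2)) :=
    ((tendsto_pow_atTop_nhds_zero_of_lt_one (by norm_num) (by norm_num)).const_mul _).add_const _
  have h3 : ∀ᶠ i in Filter.atTop, |a k₀| * (1 / 2 : ℝ) ^ i + τ / 2 ≤ τ :=
    h2.eventually_le_const (by linarith)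
  obtain ⟨i₀, hi₀⟩ := Filter.eventually_atTop.1 h3
  filter_upwards [Filter.eventually_ge_atTop (k₀ + i₀)] with k hk
  obtain ⟨i, rfl⟩ := Nat.exists_eq_add_of_le (show k₀ ≤ k by omega)
  exact (h1 i).trans (hi₀ i (by omega))

/-! ### Growth of the indices. -/

section Index

variable {G : Type*} [Group G] {L : ℕ → Subgroup G}

theorem IsSeparatingNestedSeq.two_mul_index_le (hL : IsSeparatingNestedSeq L) {i j : ℕ}
    (hij : i ≤ j) (hne : L j ≠ L i) : 2 * (L i).index ≤ (L j).index := by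
  have hle := hL.nested hij
  have := hL.finiteIndex j
  rw [← Subgroup.relIndex_mul_index hle]
  have h1 : (L j).relIndex (L i) ≠ 1 := fun h => hne (le_antisymm hle (Subgroup.relIndex_eq_one.1 h))
  have h0 : (L j).relIndex (L i) ≠ 0 := left_ne_zero_of_mul
    ((Subgroup.relIndex_mul_index hle).symm ▸ Subgroup.FiniteIndex.index_ne_zero)
  exact Nat.mul_le_mul_right _ (by omega)

theorem IsSeparatingNestedSeq.index_mono (hL : IsSeparatingNestedSeq L) {i j : ℕ}
    (hij : i ≤ j) : (L i).index ≤ (L j).index := by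
  have := hL.finiteIndex j
  exact Subgroup.index_antitone (hL.nested hij)

theorem IsSeparatingNestedSeq.eventually_le_index [Infinite G] (hL : IsSeparatingNestedSeq L)
    (c : ℕ) : ∀ᶠ j in Filter.atTop, c ≤ (L j).index := by
  obtain ⟨F, hF⟩ := Infinite.exists_subset_card_eq G c
  filter_upwards [hL.eventually_sepMod F] with j hj
  have := hL.finiteIndex j
  rw [← hF]
  exact hj.card_le

theorem IsSeparatingNestedSeq.exists_next [Infinite G] (hL : IsSeparatingNestedSeq L) (b : ℕ) :
    ∃ j, b < j ∧ L j ≠ L b ∧ ∀ i, b ≤ i → i < j → L i = L b := by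
  classical
  have hex : ∃ j, b < j ∧ L j ≠ L b := by
    obtain ⟨j, hj, hbj⟩ := ((hL.eventually_le_index ((L b).index + 1)).and
      (Filter.eventually_gt_atTop b)).exists
    exact ⟨j, hbj, fun h => by rw [h] at hj; omega⟩
  refine ⟨Nat.find hex, (Nat.find_spec hex).1, (Nat.find_spec hex).2, fun i hbi hi => ?_⟩
  rcases hbi.eq_or_lt with rfl | hbi
  · rfl
  · by_contra h
    exact Nat.find_min hex hi ⟨hbi, h⟩

end Index

/-! ### Nested transversals with vanishing relative boundary. -/

section FreeChain

variable {G : Type*} [Group G] [DecidableEq G] [Infinite G] {L : ℕ → Subgroup G}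
  {w : G × G → ℝ}

/-- One strict drop of the subgroup offsets the factor `2` in `defect_extendMod_le` by doubling the
index; a second one makes the relative defect contract. Over both drops the bound is `2 * e / 4 + 2
* δ / 2 + δ = e / 2 + 2 * δ`. -/
theorem IsSeparatingNestedSeq.exists_chunk (hL : IsSeparatingNestedSeq L) (hw : IsWeight w)
    {R : ℕ → Finset G} (hR : ∀ j, IsTransv (L j) (R j)) {b : ℕ} {δ : ℝ} (hδ : 0 ≤ δ)
    (hRδ : ∀ j, b ≤ j → defect w (R j) ≤ δ * (R j).card)
    {E : Finset G} (hE : IsTransv (L b) E) {e : ℝ} (hEe : defect w E ≤ e * E.card) :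
    ∃ (C : ℕ → Finset G) (m : ℕ), b < m ∧ C b = E ∧
      (∀ j, b ≤ j → j < m → IsTransv (L j) (C j) ∧ C j ⊆ C (j + 1) ∧
        defect w (C j) ≤ (e + δ) * (C j).card) ∧
      IsTransv (L m) (C m) ∧ defect w (C m) ≤ (e / 2 + 2 * δ) * (C m).card := by
  obtain ⟨j₁, hbj, hne₁, heq₁⟩ := hL.exists_next b
  obtain ⟨m, hjm, hne₂, heq₂⟩ := hL.exists_next j₁
  have hN := hL.normal
  -- At `m`, the set `R m` is first made to contain the admissible points of `R j₁`; otherwise the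
  -- last inclusion could fail.
  set C : ℕ → Finset G := fun j => if j < j₁ then E else if j < m then extendMod (L j) E (R j₁)
    else extendMod (L j) E (extendMod (L j) (R j₁) (R m))
  have hC0 : ∀ j, j < j₁ → C j = E := fun j h => if_pos h
  have hC1 : ∀ j, j₁ ≤ j → j < m → C j = extendMod (L j) E (R j₁) := fun j h h' => by
    simp only [C]; rw [if_neg (not_lt.2 h), if_pos h']
  have hC2 : C m = extendMod (L m) E (extendMod (L m) (R j₁) (R m)) := by
    simp only [C]; rw [if_neg (not_lt.2 hjm.le), if_neg (lt_irrefl m)]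
  have hsepE : ∀ j, b ≤ j → SepMod (L j) E := fun j h => hE.sep.of_le (hL.nested h)
  have hRm : IsTransv (L m) (extendMod (L m) (R j₁) (R m)) :=
    IsTransv.extendMod ((hR j₁).sep.of_le (hL.nested hjm.le)) (hR m)
  have hT1 : ∀ j, j₁ ≤ j → j < m → IsTransv (L j) (C j) := fun j h h' => by
    rw [hC1 j h h']
    refine IsTransv.extendMod (hsepE j (hbj.le.trans h)) ?_
    rw [heq₂ j h h']
    exact hR j₁
  have hT2 : IsTransv (L m) (C m) := by
    rw [hC2]
    exact IsTransv.extendMod (hsepE m (by omega)) hRm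
  have hi1 : 2 * (L b).index ≤ (L j₁).index := hL.two_mul_index_le hbj.le hne₁
  have hi2 : 2 * (L j₁).index ≤ (L m).index := hL.two_mul_index_le hjm.le hne₂
  have hi1' : 2 * ((L b).index : ℝ) ≤ (L j₁).index := by exact_mod_cast hi1
  have hi2' : 2 * ((L j₁).index : ℝ) ≤ (L m).index := by exact_mod_cast hi2
  have hbpos : (0 : ℝ) < (L b).index := by
    have := hL.finiteIndex b
    exact_mod_cast Nat.pos_of_ne_zero Subgroup.FiniteIndex.index_ne_zero
  have hRj₁ := hRδ j₁ hbj.le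
  have hRmδ := hRδ m (by omega)
  rw [(hR j₁).card] at hRj₁
  rw [(hR m).card] at hRmδ
  rw [hE.card] at hEe
  have he : 0 ≤ e := by
    have := (hw.defect_nonneg E).trans hEe
    exact nonneg_of_mul_nonneg_left this hbpos
  refine ⟨C, m, by omega, hC0 b hbj, fun j h h' => ?_, hT2, ?_⟩
  · rcases lt_or_ge j j₁ with h1 | h1
    · rw [hC0 j h1]
      refine ⟨?_, ?_, ?_⟩
      · rw [heq₁ j h h1]; exact hE
      · rcases lt_or_ge (j + 1) j₁ with h2 | h2
        · rw [hC0 _ h2]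
        · rw [hC1 _ h2 (by omega)]
          exact subset_extendMod _ _ _
      · rw [hE.card]
        nlinarith
    · refine ⟨hT1 j h1 h', ?_, ?_⟩
      · rw [hC1 j h1 h']
        rcases (show j + 1 ≤ m from h').lt_or_eq with h2 | h2
        · rw [hC1 _ (by omega) h2]
          exact extendMod_mono (hL.nested (Nat.le_succ j)) E (Finset.Subset.refl _)
        · rw [h2, hC2]
          exact extendMod_mono (hL.nested h'.le) E (subset_extendMod _ _ _)
      · have h3 := hw.defect_extendMod_le (L j) E (R := R j₁)
          ((hR j₁).sep.of_le (hL.nested h1))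
        rw [(hT1 j h1 h').card, heq₂ j h1 h']
        rw [← hC1 j h1 h'] at h3
        nlinarith
  · have h3 := hw.defect_extendMod_le (L m) E hRm.sep
    have h4 := hw.defect_extendMod_le (L m) (R j₁) (hR m).sep
    rw [← hC2] at h3
    rw [hT2.card]
    have h5 : e * (2 * (L j₁).index) ≤ e * (L m).index := mul_le_mul_of_nonneg_left hi2' he
    have h6 : δ * (2 * (L j₁).index) ≤ δ * (L m).index := mul_le_mul_of_nonneg_left hi2' hδ
    have h7 : e * (2 * (L b).index) ≤ e * (L j₁).index := mul_le_mul_of_nonneg_left hi1' he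
    linarith

/-- A transversal with small boundary starts a nested chain of transversals whose boundaries stay
small and become negligible. -/
theorem IsSeparatingNestedSeq.exists_chain (hL : IsSeparatingNestedSeq L) (hw : IsWeight w)
    {R : ℕ → Finset G} (hR : ∀ j, IsTransv (L j) (R j)) {δ : ℕ → ℝ} (hδ : Antitone δ)
    (hδ0 : Filter.Tendsto δ Filter.atTop (𝓝 0))
    (hRδ : ∀ j, defect w (R j) ≤ δ j * (R j).card) {p : ℕ} {K : Finset G}
    (hK : IsTransv (L p) K) {e : ℝ} (he : 0 ≤ e) (hKe : defect w K ≤ e * K.card) :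
    ∃ C : ℕ → Finset G, C p = K ∧
      (∀ j, p ≤ j → IsTransv (L j) (C j) ∧ C j ⊆ C (j + 1) ∧
        defect w (C j) ≤ (e + 5 * δ p) * (C j).card) ∧
      ∀ τ : ℝ, 0 < τ → ∀ᶠ j in Filter.atTop, defect w (C j) ≤ τ * (C j).card := by
  have hδnn : ∀ j, 0 ≤ δ j := fun j => hδ.le_of_tendsto hδ0 j
  let ε : ℕ → ℝ := fun k => Nat.rec e (fun k x => x / 2 + 2 * δ (p + k)) k
  have hε : ∀ k, ε (k + 1) = ε k / 2 + 2 * δ (p + k) := fun k => rfl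
  -- `4 * δ p` is the fixed point of `x ↦ x / 2 + 2 * δ p`.
  have hεle : ∀ k, ε k ≤ e + 4 * δ p := by
    intro k
    induction k with
    | zero => change e ≤ _; linarith [hδnn p]
    | succ k ih =>
      rw [hε]
      have := hδ (Nat.le_add_right p k)
      linarith
  obtain ⟨C, n, hn0, hC0, hn, hrel, hinv, -⟩ := exists_concat
    (Inv := fun k b K => p + k ≤ b ∧ IsTransv (L b) K ∧ defect w K ≤ ε k * K.card)
    (Rel := fun k j A B => IsTransv (L j) A ∧ A ⊆ B ∧
      defect w A ≤ (ε k + δ (p + k)) * A.card)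
    (Link := fun _ _ _ => True)
    (by
      rintro k b E ⟨hkb, hE, hEe⟩
      obtain ⟨C, m, hbm, hCb, hCj, hCm, hCme⟩ := hL.exists_chunk hw hR (b := b) (hδnn (p + k))
        (fun j hj => (hRδ j).trans (mul_le_mul_of_nonneg_right (hδ (hkb.trans hj))
          (Nat.cast_nonneg _))) hE hEe
      exact ⟨C, m, hbm, hCb, hCj, ⟨by omega, hCm, hCme⟩, trivial⟩)
    (p₀ := p) (K₀ := K) ⟨by omega, hK, hKe⟩
  refine ⟨C, hC0, fun j hj => ?_, fun τ hτ => ?_⟩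
  · obtain ⟨k, h1, h2⟩ := hn.exists_mem_interval (j := j) (by rwa [hn0])
    obtain ⟨h3, h4, h5⟩ := hrel k j h1 h2
    refine ⟨h3, h4, h5.trans (mul_le_mul_of_nonneg_right ?_ (Nat.cast_nonneg _))⟩
    have := hδ (Nat.le_add_right p k)
    linarith [hεle k]
  · have hshift : Filter.Tendsto (fun k => δ (p + k)) Filter.atTop (𝓝 0) := by
      refine hδ0.comp ?_
      exact Filter.tendsto_atTop_mono (fun k => Nat.le_add_left k p) Filter.tendsto_id
    have h1 : ∀ᶠ k in Filter.atTop, ε k ≤ τ / 2 :=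
      eventually_le_of_half_step (b := fun k => 2 * δ (p + k))
        (by simpa using hshift.const_mul 2) (fun k => (hε k).le) (half_pos hτ)
    obtain ⟨k₀, hk₀⟩ := Filter.eventually_atTop.1
      (h1.and (hshift.eventually_le_const (half_pos hτ)))
    filter_upwards [Filter.eventually_ge_atTop (n k₀)] with j hj
    obtain ⟨k, h2, h3⟩ := hn.exists_mem_interval ((hn.monotone (Nat.zero_le k₀)).trans hj)
    have hk : k₀ ≤ k := by
      by_contra! h
      exact absurd (h3.trans_le (hn.monotone h)) (not_lt.2 hj)
    refine (hrel k j h2 h3).2.2.trans (mul_le_mul_of_nonneg_right ?_ (Nat.cast_nonneg _))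
    linarith [hk₀ k hk]

end FreeChain

/-! ### The tiling of the group by translates of a transversal. -/

section Blocks

variable {G : Type*} [Group G]

/-- `κ x` is the representative in the transversal `K` of the coset `x P`. -/
structure IsRepFun (P : Subgroup G) (K : Finset G) (κ : G → G) : Prop where
  mem : ∀ x, κ x ∈ K
  coset : ∀ x : G, (κ x : G ⧸ P) = x
  unique : ∀ x : G, ∀ k ∈ K, (k : G ⧸ P) = x → k = κ x

theorem IsTransv.exists_isRepFun {P : Subgroup G} {K : Finset G} (hK : IsTransv P K) :
    ∃ κ, IsRepFun P K κ := by
  choose κ hκ hκx using hK.cover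
  exact ⟨κ, hκ, hκx, fun x k hk hkx => hK.sep k hk _ (hκ x) (hkx.trans (hκx x).symm)⟩

/-- The coordinate `l` of the point `x = k * l` in the tiling by the translates of `K`. -/
def blockCoord (κ : G → G) (x : G) : G := (κ x)⁻¹ * x

theorem mul_blockCoord (κ : G → G) (x : G) : κ x * blockCoord κ x = x := mul_inv_cancel_left _ _

variable {P : Subgroup G} {K : Finset G} {κ : G → G}

theorem IsRepFun.blockCoord_mem (hκ : IsRepFun P K κ) (x : G) : blockCoord κ x ∈ P :=
  QuotientGroup.eq.1 (hκ.coset x)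

theorem IsRepFun.blockCoord_mul (hκ : IsRepFun P K κ) {k l : G} (hk : k ∈ K) (hl : l ∈ P) :
    blockCoord κ (k * l) = l := by
  have h : k = κ (k * l) := hκ.unique (k * l) k hk (QuotientGroup.eq.2 (by simpa using hl))
  rw [blockCoord, ← h, inv_mul_cancel_left]

/-- `A` is a union of translates `K * l`. -/
def IsBlocky (κ : G → G) (A : Finset G) : Prop :=
  ∀ x ∈ A, ∀ y, blockCoord κ y = blockCoord κ x → y ∈ A

/-- Congruent points modulo `M ≤ P` have the same position in their blocks. Moving both to another
common position leaves `x⁻¹ * y` unchanged, so the two blocks meet the same cosets of `M`. -/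
theorem IsRepFun.exists_congr (hκ : IsRepFun P K κ) {M : Subgroup G} (hM : M ≤ P) {x x' y : G}
    (hx : blockCoord κ x' = blockCoord κ x) (hxy : (x : G ⧸ M) = y) :
    ∃ y', blockCoord κ y' = blockCoord κ y ∧ (x' : G ⧸ M) = y' := by
  have hk : κ x = κ y := hκ.unique y _ (hκ.mem x)
    ((hκ.coset x).trans (quotient_eq_of_le hM hxy))
  refine ⟨κ x' * blockCoord κ y, hκ.blockCoord_mul (hκ.mem _) (hκ.blockCoord_mem _), ?_⟩
  rw [QuotientGroup.eq] at hxy ⊢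
  have h : x' = κ x' * blockCoord κ x := by rw [← hx, mul_blockCoord]
  have h2 : x'⁻¹ * (κ x' * blockCoord κ y) = x⁻¹ * y := by
    nth_rewrite 1 [h]
    simp only [blockCoord, hk]
    group
  rwa [h2]

variable [DecidableEq G]

theorem IsRepFun.isBlocky_extendMod (hκ : IsRepFun P K κ) {M : Subgroup G} (hM : M ≤ P)
    {E R : Finset G} (hE : IsBlocky κ E) (hR : IsBlocky κ R) : IsBlocky κ (extendMod M E R) := by
  intro x hx y hyx
  rcases mem_extendMod.1 hx with hx | ⟨hx, hxE⟩
  · exact subset_extendMod _ _ _ (hE x hx y hyx)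
  · refine mem_extendMod.2 (Or.inr ⟨hR x hx y hyx, fun e he hey => ?_⟩)
    obtain ⟨e', he', hxe'⟩ := hκ.exists_congr hM hyx.symm hey.symm
    exact hxE e' (hE e he e' he') hxe'.symm

/-- The union of the blocks that meet `A`. -/
def blockHull (K : Finset G) (κ : G → G) (A : Finset G) : Finset G :=
  (K ×ˢ A).image (fun p => p.1 * blockCoord κ p.2)

theorem IsRepFun.mem_blockHull (hκ : IsRepFun P K κ) {A : Finset G} {y : G} :
    y ∈ blockHull K κ A ↔ ∃ x ∈ A, blockCoord κ y = blockCoord κ x := by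
  simp only [blockHull, Finset.mem_image, Finset.mem_product, Prod.exists]
  constructor
  · rintro ⟨k, x, ⟨hk, hx⟩, rfl⟩
    exact ⟨x, hx, hκ.blockCoord_mul hk (hκ.blockCoord_mem x)⟩
  · rintro ⟨x, hx, h⟩
    exact ⟨κ y, x, ⟨hκ.mem y, hx⟩, by rw [← h, mul_blockCoord]⟩

theorem IsRepFun.isBlocky_blockHull (hκ : IsRepFun P K κ) (A : Finset G) :
    IsBlocky κ (blockHull K κ A) := by
  intro x hx y hyx
  rw [hκ.mem_blockHull] at hx ⊢
  obtain ⟨z, hz, hxz⟩ := hx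
  exact ⟨z, hz, hyx.trans hxz⟩

/-- The union of the blocks contained in `A`. -/
def blockCore (K : Finset G) (κ : G → G) (A : Finset G) : Finset G :=
  A.filter (fun x => ∀ k ∈ K, k * blockCoord κ x ∈ A)

theorem IsRepFun.isBlocky_blockCore (hκ : IsRepFun P K κ) (A : Finset G) :
    IsBlocky κ (blockCore K κ A) := by
  intro x hx y hyx
  have hx := (Finset.mem_filter.1 hx).2
  refine Finset.mem_filter.2 ⟨?_, by rwa [hyx]⟩
  rw [← mul_blockCoord κ y, hyx]
  exact hx _ (hκ.mem y)

/-- Moving inside a block is left multiplication by some `k * k'⁻¹` with `k, k' ∈ K`. A block only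
partly in `C` is therefore seen by one of finitely many boundaries, so `M` depends on `K` and `w`
but not on `C`. -/
theorem IsWeight.exists_blockHull_blockCore_bound {w : G × G → ℝ} (hw : IsWeight w)
    (hκ : IsRepFun P K κ) : ∃ M : ℝ, 0 ≤ M ∧ ∀ C : Finset G,
      ((C \ blockCore K κ C).card : ℝ) ≤ M * defect w C ∧
      ((blockHull K κ C \ C).card : ℝ) ≤ M * defect w C := by
  have hb : ∀ C : Finset G,
      ((∑ p ∈ K ×ˢ K, boundaryCard (p.1 * p.2⁻¹, (1 : G)) C : ℕ) : ℝ) ≤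
        (∑ p ∈ K ×ˢ K, (w (p.1 * p.2⁻¹, 1))⁻¹) * defect w C := by
    intro C
    push_cast
    rw [Finset.sum_mul]
    refine Finset.sum_le_sum (fun p _ => ?_)
    rw [inv_mul_eq_div, le_div_iff₀ (hw.pos _), mul_comm]
    exact hw.mul_boundaryCard_le _ _
  have hmove : ∀ x k, ((k * (κ x)⁻¹, (1 : G)) : G × G) • x = k * blockCoord κ x := by
    intro x k
    rw [twoSided_smul_def, blockCoord]
    simp [mul_assoc]
  refine ⟨∑ p ∈ K ×ˢ K, (w (p.1 * p.2⁻¹, 1))⁻¹,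
    Finset.sum_nonneg (fun p _ => inv_nonneg.2 (hw.pos _).le), fun C => ⟨?_, ?_⟩⟩
  · refine le_trans (Nat.cast_le.2 ?_) (hb C)
    refine (Finset.card_le_card (t := (K ×ˢ K).biUnion (fun p =>
      C.filter (fun x => ((p.1 * p.2⁻¹, (1 : G)) : G × G) • x ∉ C))) ?_).trans
        Finset.card_biUnion_le
    intro x hx
    obtain ⟨hx1, hx2⟩ := Finset.mem_sdiff.1 hx
    simp only [blockCore, Finset.mem_filter, not_and, not_forall] at hx2
    obtain ⟨k, hk, hkx⟩ := hx2 hx1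
    refine Finset.mem_biUnion.2 ⟨(k, κ x), Finset.mk_mem_product hk (hκ.mem x), ?_⟩
    refine Finset.mem_filter.2 ⟨hx1, ?_⟩
    rwa [hmove]
  · refine le_trans (Nat.cast_le.2 ?_) (hb C)
    refine (Finset.card_le_card (t := (K ×ˢ K).biUnion (fun p =>
      (C.filter (fun x => ((p.1 * p.2⁻¹, (1 : G)) : G × G) • x ∉ C)).image
        (fun x => ((p.1 * p.2⁻¹, (1 : G)) : G × G) • x))) ?_).trans
        (Finset.card_biUnion_le.trans (Finset.sum_le_sum (fun p _ => Finset.card_image_le)))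
    intro y hy
    obtain ⟨hy1, hy2⟩ := Finset.mem_sdiff.1 hy
    obtain ⟨x, hx, hyx⟩ := hκ.mem_blockHull.1 hy1
    have hyx' : ((κ y * (κ x)⁻¹, (1 : G)) : G × G) • x = y := by
      rw [hmove, ← hyx, mul_blockCoord]
    refine Finset.mem_biUnion.2 ⟨(κ y, κ x), Finset.mk_mem_product (hκ.mem y) (hκ.mem x), ?_⟩
    refine Finset.mem_image.2 ⟨x, Finset.mem_filter.2 ⟨hx, ?_⟩, hyx'⟩
    simp only
    rwa [hyx']

/-- The set is `K * (R ∩ P)`, since `R ∩ P` is a transversal of `M` in `P`. -/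
theorem IsRepFun.exists_blocky_transv (hκ : IsRepFun P K κ) {M : Subgroup G} [M.Normal]
    (hM : M ≤ P) {R : Finset G} (hR : IsTransv M R) :
    ∃ W : Finset G, IsTransv M W ∧ IsBlocky κ W := by
  classical
  have hmem : ∀ y, y ∈ (K ×ˢ R.filter (· ∈ P)).image (fun p => p.1 * p.2) ↔
      blockCoord κ y ∈ R := by
    intro y
    simp only [Finset.mem_image, Finset.mem_product, Finset.mem_filter, Prod.exists]
    constructor
    · rintro ⟨k, u, ⟨hk, hu, huP⟩, rfl⟩
      rwa [hκ.blockCoord_mul hk huP]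
    · intro h
      exact ⟨κ y, blockCoord κ y, ⟨hκ.mem y, h, hκ.blockCoord_mem y⟩, mul_blockCoord κ y⟩
  refine ⟨(K ×ˢ R.filter (· ∈ P)).image (fun p => p.1 * p.2), ⟨?_, ?_⟩, ?_⟩
  · intro x hx y hy hxy
    rw [hmem] at hx hy
    have hk : κ x = κ y := hκ.unique y _ (hκ.mem x)
      ((hκ.coset x).trans (quotient_eq_of_le hM hxy))
    have h : blockCoord κ x = blockCoord κ y := by
      refine hR.sep _ hx _ hy ?_
      rw [blockCoord, blockCoord, hk, QuotientGroup.mk_mul, QuotientGroup.mk_mul, hxy]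
    rw [← mul_blockCoord κ x, ← mul_blockCoord κ y, hk, h]
  · intro g
    obtain ⟨u, hu, hug⟩ := hR.cover (blockCoord κ g)
    have huP : u ∈ P := by
      have h1 := hM (QuotientGroup.eq.1 hug)
      have h2 := P.mul_mem (hκ.blockCoord_mem g) (P.inv_mem h1)
      simpa using h2
    refine ⟨κ g * u, (hmem _).2 ?_, ?_⟩
    · rwa [hκ.blockCoord_mul (hκ.mem g) huP]
    · rw [QuotientGroup.mk_mul, hug, ← QuotientGroup.mk_mul, mul_blockCoord]
  · intro x hx y hyx
    rw [hmem] at hx ⊢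
    rwa [hyx]

theorem IsRepFun.isDisjointUnionOfRightTranslates (hκ : IsRepFun P K κ) {D : Finset G}
    (hD : IsBlocky κ D) : IsDisjointUnionOfRightTranslates K D := by
  refine ⟨D.image (blockCoord κ), ?_, ?_⟩
  · intro t ht t' ht' htt'
    rw [Function.onFun, Finset.disjoint_left]
    intro x hx hx'
    obtain ⟨z, _, rfl⟩ := Finset.mem_image.1 (Finset.mem_coe.1 ht)
    obtain ⟨z', _, rfl⟩ := Finset.mem_image.1 (Finset.mem_coe.1 ht')
    obtain ⟨k, hk, rfl⟩ := Finset.mem_image.1 hx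
    obtain ⟨k', hk', h⟩ := Finset.mem_image.1 hx'
    apply htt'
    rw [← hκ.blockCoord_mul hk (hκ.blockCoord_mem z), ← h,
      hκ.blockCoord_mul hk' (hκ.blockCoord_mem z')]
  · ext x
    simp only [Finset.mem_biUnion, Finset.mem_image]
    constructor
    · intro hx
      exact ⟨_, ⟨x, hx, rfl⟩, κ x, hκ.mem x, mul_blockCoord κ x⟩
    · rintro ⟨_, ⟨z, hz, rfl⟩, k, hk, rfl⟩
      exact hD z hz _ (hκ.blockCoord_mul hk (hκ.blockCoord_mem z))

omit [DecidableEq G] in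
theorem exists_sepMod_subset (M : Subgroup G) (H : Finset G) :
    ∃ V ⊆ H, SepMod M V ∧ ∀ h ∈ H, ∃ v ∈ V, (v : G ⧸ M) = h := by
  obtain ⟨s, hs, hbij⟩ := (H : Set G).exists_subset_bijOn (fun x => (x : G ⧸ M))
  have hfin : s.Finite := H.finite_toSet.subset hs
  refine ⟨hfin.toFinset, fun x hx => hs (hfin.mem_toFinset.1 hx), ?_, fun h hh => ?_⟩
  · intro x hx y hy hxy
    exact hbij.injOn (hfin.mem_toFinset.1 hx) (hfin.mem_toFinset.1 hy) hxy
  · obtain ⟨v, hv, hvh⟩ := hbij.surjOn ⟨h, hh, rfl⟩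
    exact ⟨v, hfin.mem_toFinset.2 hv, hvh⟩

/-- `D` is a transversal of `M` made of whole blocks outside the cosets of `M` that meet `H`, and
of points of `H` inside them. -/
structure IsBlockyOff (κ : G → G) (H : Finset G) (M : Subgroup G) (D : Finset G) : Prop where
  transv : IsTransv M D
  mem_of_congr : ∀ x ∈ D, ∀ h ∈ H, (h : G ⧸ M) = x → x ∈ H
  blocky : ∀ x ∈ D, (∀ h ∈ H, (h : G ⧸ M) ≠ x) → ∀ y, blockCoord κ y = blockCoord κ x → y ∈ D

/-- `V` fills the new cosets that meet `H`, and `B` fills the others. A block of `B` is kept or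
discarded as a whole: by `exists_congr` a collision at one of its points forces a collision with `H`
or with a whole block of `D` at every other point. -/
theorem IsBlockyOff.extendMod (hκ : IsRepFun P K κ) {H D V B : Finset G} {M M' : Subgroup G}
    (hM' : M' ≤ M) (hM : M ≤ P) (hH : IsBlocky κ H) (hD : IsBlockyOff κ H M D) (hVH : V ⊆ H)
    (hVsep : SepMod M' V) (hV : ∀ h ∈ H, ∃ v ∈ V, (v : G ⧸ M') = h) (hB : IsTransv M' B)
    (hBblock : IsBlocky κ B) :
    IsBlockyOff κ H M' (extendMod M' (extendMod M' D V) B) := by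
  have hsep : SepMod M' (_root_.extendMod M' D V) := (hD.transv.sep.of_le hM').extendMod hVsep
  refine ⟨IsTransv.extendMod hsep hB, ?_, ?_⟩
  · intro x hx h hh hhx
    rcases mem_extendMod.1 hx with hx | ⟨-, hx⟩
    · rcases mem_extendMod.1 hx with hx | ⟨hx, -⟩
      · exact hD.mem_of_congr x hx h hh (quotient_eq_of_le hM' hhx)
      · exact hVH hx
    · obtain ⟨e, he, heh⟩ := exists_mem_extendMod_right (E := D) (hV h hh)
      exact absurd (heh.trans hhx) (hx e he)
  · intro x hx hxH y hyx
    have hnotH : x ∉ H := fun h => hxH x h rfl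
    rcases mem_extendMod.1 hx with hx | ⟨hxB, hx⟩
    · rcases mem_extendMod.1 hx with hx | ⟨hx, -⟩
      · refine subset_extendMod _ _ _ (subset_extendMod _ _ _ (hD.blocky x hx ?_ y hyx))
        exact fun h hh hhx => hnotH (hD.mem_of_congr x hx h hh hhx)
      · exact absurd (hVH hx) hnotH
    · refine mem_extendMod.2 (Or.inr ⟨hBblock x hxB y hyx, fun e he hey => ?_⟩)
      obtain ⟨e', he', hxe'⟩ := hκ.exists_congr (hM'.trans hM) hyx.symm hey.symm
      by_cases heH : e ∈ H
      · exact hxH e' (hH e heH e' he') hxe'.symm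
      · rcases mem_extendMod.1 he with heD | ⟨heV, -⟩
        · refine hx e' (subset_extendMod _ _ _ (hD.blocky e heD ?_ e' he')) hxe'.symm
          exact fun h hh hhe => heH (hD.mem_of_congr e heD h hh hhe)
        · exact heH (hVH heV)

omit [DecidableEq G] in
-- Once `M` separates `H`, the point of `D` in the coset of `h ∈ H` lies in `H`, hence equals `h`.
theorem IsBlockyOff.subset_and_isBlocky {H D : Finset G} {M : Subgroup G} (hH : IsBlocky κ H)
    (hD : IsBlockyOff κ H M D) (hsep : SepMod M H) : H ⊆ D ∧ IsBlocky κ D := by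
  have hsub : H ⊆ D := by
    intro h hh
    obtain ⟨x, hx, hxh⟩ := hD.transv.cover h
    have hxH := hD.mem_of_congr x hx h hh hxh.symm
    rwa [← hsep x hxH h hh hxh]
  refine ⟨hsub, fun x hx y hyx => ?_⟩
  by_cases hxH : ∀ h ∈ H, (h : G ⧸ M) ≠ x
  · exact hD.blocky x hx hxH y hyx
  · push Not at hxH
    obtain ⟨h, hh, hhx⟩ := hxH
    exact hsub (hH x (hD.mem_of_congr x hx h hh hhx) y hyx)

end Blocks

/-! ### Steering a chain to a set tiled by a given transversal. -/

section Stage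

variable {G : Type*} [Group G] [DecidableEq G] [Infinite G] {L : ℕ → Subgroup G}
  {w : G × G → ℝ}

theorem IsSeparatingNestedSeq.exists_blocky_chain (hL : IsSeparatingNestedSeq L) (hw : IsWeight w)
    {R : ℕ → Finset G} (hR : ∀ j, IsTransv (L j) (R j)) {p : ℕ} {K : Finset G}
    (hK : IsTransv (L p) K) {C : ℕ → Finset G}
    (hC : ∀ j, p ≤ j → IsTransv (L j) (C j) ∧ C j ⊆ C (j + 1))
    (hC0 : ∀ τ : ℝ, 0 < τ → ∀ᶠ j in Filter.atTop, defect w (C j) ≤ τ * (C j).card)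
    (g : G) {ε : ℝ} (hε : 0 < ε) :
    ∃ (D : ℕ → Finset G) (J : ℕ), p < J ∧ (∀ j, j ≤ J → D j = C j) ∧
      (∀ j, J ≤ j → IsTransv (L j) (D j) ∧ D j ⊆ D (j + 1) ∧ defect w (D j) ≤ ε * (D j).card) ∧
      ∀ᶠ m in Filter.atTop, g ∈ D m ∧ IsDisjointUnionOfRightTranslates K (D m) := by
  have hN := hL.normal
  obtain ⟨κ, hκ⟩ := hK.exists_isRepFun
  obtain ⟨M, hM0, hM⟩ := hw.exists_blockHull_blockCore_bound hκ
  -- The final bound is `τ + 2 * (2 * M * τ + M * τ + τ) = τ * (6 * M + 3)`: the defect of `C j`,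
  -- then twice the points outside `C j ∪ H`, in the hull of `C J`, and in the block of `g`.
  set τ := ε / (6 * M + 3)
  have hτ : 0 < τ := by positivity
  obtain ⟨c, hc⟩ := exists_nat_gt ((K.card : ℝ) / τ)
  obtain ⟨J, hJ⟩ := Filter.eventually_atTop.1
    (((hC0 τ hτ).and (hL.eventually_le_index c)).and (Filter.eventually_gt_atTop p))
  have hpJ : p < J := (hJ J le_rfl).2
  have hCJ : ∀ j, J ≤ j → IsTransv (L j) (C j) := fun j hj => (hC j (by omega)).1
  have hCmono : ∀ i j, p ≤ i → i ≤ j → C i ⊆ C j := fun i j hi hij => by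
    induction j, hij using Nat.le_induction with
    | base => exact Finset.Subset.refl _
    | succ j hij ih => exact ih.trans (hC j (by omega)).2
  have hdC : ∀ j, J ≤ j → defect w (C j) ≤ τ * (L j).index := fun j hj => by
    rw [← (hCJ j hj).card]; exact (hJ j hj).1.1
  have hKτ : ∀ j, J ≤ j → (K.card : ℝ) ≤ τ * (L j).index := fun j hj => by
    have h1 : (c : ℝ) ≤ (L j).index := by exact_mod_cast (hJ j hj).1.2
    rw [div_lt_iff₀ hτ] at hc
    nlinarith
  set H := blockHull K κ (insert g (C J))
  have hH : IsBlocky κ H := hκ.isBlocky_blockHull _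
  have hsubH : insert g (C J) ⊆ H := fun x hx => hκ.mem_blockHull.2 ⟨x, hx, rfl⟩
  choose V hVH hVsep hVcov using fun j => exists_sepMod_subset (L j) H
  have hWex : ∀ j, ∃ W : Finset G, J ≤ j → IsTransv (L j) W ∧ IsBlocky κ W := fun j => by
    by_cases hj : J ≤ j
    · obtain ⟨W, hW⟩ := hκ.exists_blocky_transv (hL.nested (by omega : p ≤ j)) (hR j)
      exact ⟨W, fun _ => hW⟩
    · exact ⟨∅, fun h => absurd h hj⟩
  choose W hW using hWex
  set B : ℕ → Finset G := fun j => extendMod (L j) (blockCore K κ (C j)) (W j)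
  have hcore : ∀ A, blockCore K κ A ⊆ A := fun A => Finset.filter_subset _ _
  have hB : ∀ j, J ≤ j → IsTransv (L j) (B j) := fun j hj =>
    IsTransv.extendMod ((hCJ j hj).sep.mono (hcore _)) (hW j hj).1
  have hBblocky : ∀ j, J ≤ j → IsBlocky κ (B j) := fun j hj =>
    hκ.isBlocky_extendMod (hL.nested (by omega)) (hκ.isBlocky_blockCore _) (hW j hj).2
  have hBC : ∀ j, J ≤ j → ((B j \ C j).card : ℝ) ≤ M * (τ * (L j).index) := fun j hj => by
    have h1 : (B j \ C j).card = (C j \ B j).card :=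
      Finset.card_sdiff_comm ((hB j hj).card.trans (hCJ j hj).card.symm)
    have h2 : C j \ B j ⊆ C j \ blockCore K κ (C j) :=
      Finset.sdiff_subset_sdiff (Finset.Subset.refl _) (subset_extendMod _ _ _)
    rw [h1]
    exact (Nat.cast_le.2 (Finset.card_le_card h2)).trans
      ((hM _).1.trans (mul_le_mul_of_nonneg_left (hdC j hj) hM0))
  -- `D` follows `C` up to `J`; later, cosets meeting `H` are filled from `H` and the other new
  -- cosets by whole blocks of `B j`, which is close to `C j`.
  let D : ℕ → Finset G := fun j => Nat.rec (C 0) (fun j X => if j + 1 ≤ J then C (j + 1)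
    else extendMod (L (j + 1)) (extendMod (L (j + 1)) X (V (j + 1))) (B (j + 1))) j
  have hDle : ∀ j, j ≤ J → D j = C j := fun j hj => by
    cases j with
    | zero => rfl
    | succ j => exact if_pos hj
  have hDsucc : ∀ j, J ≤ j → D (j + 1) =
      extendMod (L (j + 1)) (extendMod (L (j + 1)) (D j) (V (j + 1))) (B (j + 1)) :=
    fun j hj => if_neg (by omega)
  have hDoff : ∀ j, J ≤ j → IsBlockyOff κ H (L j) (D j) := by
    intro j hj
    induction j, hj using Nat.le_induction with
    | base =>
      rw [hDle J le_rfl]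
      -- At `J` every coset meets `H`, because the transversal `C J` lies in `H`; the block
      -- condition is vacuous.
      have hmem : ∀ x ∈ C J, x ∈ H := fun x hx => hsubH (Finset.mem_insert_of_mem hx)
      exact ⟨hCJ J le_rfl, fun x hx _ _ _ => hmem x hx,
        fun x hx h => absurd rfl (h x (hmem x hx))⟩
    | succ j hj ih =>
      rw [hDsucc j hj]
      exact ih.extendMod hκ (hL.nested (Nat.le_succ j)) (hL.nested (by omega)) hH (hVH _)
        (hVsep _) (hVcov _) (hB _ (by omega)) (hBblocky _ (by omega))
  have hDmono : ∀ j, J ≤ j → D j ⊆ D (j + 1) := fun j hj => by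
    rw [hDsucc j hj]
    exact (subset_extendMod _ _ _).trans (subset_extendMod _ _ _)
  -- `D` changes only when `L j` drops, and then the index doubles: the errors `M * τ * index` form
  -- a geometric sum, whence the factor `2`.
  have hDcard : ∀ j, J ≤ j →
      ((D j \ (C j ∪ H)).card : ℝ) ≤ 2 * (M * (τ * (L j).index)) := by
    intro j hj
    induction j, hj using Nat.le_induction with
    | base =>
      rw [hDle J le_rfl, Finset.sdiff_eq_empty_iff_subset.2 Finset.subset_union_left]
      simp only [Finset.card_empty, Nat.cast_zero]
      positivity
    | succ j hj ih =>
      have hCj : C j ⊆ C (j + 1) := (hC j (by omega)).2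
      by_cases hne : L (j + 1) = L j
      · have hDeq : D (j + 1) = D j := by
          have ht : IsTransv (L (j + 1)) (D j) := hne ▸ (hDoff j hj).transv
          rw [hDsucc j hj, ht.extendMod_eq, ht.extendMod_eq]
        rw [hDeq, hne]
        refine le_trans (Nat.cast_le.2 (Finset.card_le_card ?_)) ih
        exact Finset.sdiff_subset_sdiff (Finset.Subset.refl _)
          (Finset.union_subset_union hCj (Finset.Subset.refl _))
      · have hsub : D (j + 1) \ (C (j + 1) ∪ H) ⊆
            (D j \ (C j ∪ H)) ∪ (B (j + 1) \ C (j + 1)) := by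
          intro x hx
          obtain ⟨hx1, hx2⟩ := Finset.mem_sdiff.1 hx
          rw [Finset.mem_union, not_or] at hx2
          rw [hDsucc j hj] at hx1
          rw [Finset.mem_union, Finset.mem_sdiff, Finset.mem_sdiff, Finset.mem_union, not_or]
          rcases mem_extendMod.1 hx1 with hx1 | ⟨hx1, -⟩
          · rcases mem_extendMod.1 hx1 with hx1 | ⟨hx1, -⟩
            · exact Or.inl ⟨hx1, fun h => hx2.1 (hCj h), hx2.2⟩
            · exact absurd (hVH _ hx1) hx2.2
          · exact Or.inr ⟨hx1, hx2.1⟩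
        have h1 : ((D (j + 1) \ (C (j + 1) ∪ H)).card : ℝ) ≤
            (D j \ (C j ∪ H)).card + (B (j + 1) \ C (j + 1)).card := by
          exact_mod_cast (Finset.card_le_card hsub).trans (Finset.card_union_le _ _)
        have h2 := hBC (j + 1) (by omega)
        have h3 : 2 * ((L j).index : ℝ) ≤ (L (j + 1)).index := by
          exact_mod_cast hL.two_mul_index_le (Nat.le_succ j) hne
        have h4 : M * τ * (2 * ((L j).index : ℝ)) ≤ M * τ * (L (j + 1)).index :=
          mul_le_mul_of_nonneg_left h3 (by positivity)
        linarith
  have hHC : ((H \ C J).card : ℝ) ≤ M * (τ * (L J).index) + K.card := by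
    have hsub : H \ C J ⊆ (blockHull K κ (C J) \ C J) ∪ K.image (fun k => k * blockCoord κ g) := by
      intro y hy
      obtain ⟨hy1, hy2⟩ := Finset.mem_sdiff.1 hy
      obtain ⟨x, hx, hyx⟩ := hκ.mem_blockHull.1 hy1
      rcases Finset.mem_insert.1 hx with rfl | hx
      · refine Finset.mem_union_right _ (Finset.mem_image.2 ⟨κ y, hκ.mem y, ?_⟩)
        rw [← hyx, mul_blockCoord]
      · exact Finset.mem_union_left _
          (Finset.mem_sdiff.2 ⟨hκ.mem_blockHull.2 ⟨x, hx, hyx⟩, hy2⟩)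
    have h1 : ((H \ C J).card : ℝ) ≤ (blockHull K κ (C J) \ C J).card +
        (K.image (fun k => k * blockCoord κ g)).card := by
      exact_mod_cast (Finset.card_le_card hsub).trans (Finset.card_union_le _ _)
    have h2 : ((K.image (fun k => k * blockCoord κ g)).card : ℝ) ≤ K.card := by
      exact_mod_cast Finset.card_image_le
    have h3 := (hM (C J)).2.trans (mul_le_mul_of_nonneg_left (hdC J le_rfl) hM0)
    linarith
  refine ⟨D, J, hpJ, hDle, fun j hj => ⟨(hDoff j hj).transv, hDmono j hj, ?_⟩, ?_⟩
  · have hDt := (hDoff j hj).transv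
    have h1 := hw.defect_le_of_card_eq (hDt.card.trans (hCJ j hj).card.symm)
    have hsub : D j \ C j ⊆ (D j \ (C j ∪ H)) ∪ (H \ C J) := by
      intro x hx
      obtain ⟨hx1, hx2⟩ := Finset.mem_sdiff.1 hx
      by_cases hxH : x ∈ H
      · exact Finset.mem_union_right _ (Finset.mem_sdiff.2
          ⟨hxH, fun h => hx2 (hCmono J j hpJ.le hj h)⟩)
      · refine Finset.mem_union_left _ (Finset.mem_sdiff.2 ⟨hx1, ?_⟩)
        rw [Finset.mem_union, not_or]
        exact ⟨hx2, hxH⟩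
    have h2 : ((D j \ C j).card : ℝ) ≤ (D j \ (C j ∪ H)).card + (H \ C J).card := by
      exact_mod_cast (Finset.card_le_card hsub).trans (Finset.card_union_le _ _)
    have h3 : ((L J).index : ℝ) ≤ (L j).index := by exact_mod_cast hL.index_mono hj
    have h4 : M * (τ * (L J).index) ≤ M * (τ * (L j).index) := by gcongr
    have h5 := hDcard j hj
    have h6 := hdC j hj
    have h7 := hKτ j hj
    rw [hDt.card]
    have h8 : ε = τ * (6 * M + 3) := by simp only [τ]; field_simp
    rw [h8]
    nlinarith
  · filter_upwards [hL.eventually_sepMod H, Filter.eventually_ge_atTop J] with m hm hJm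
    obtain ⟨h1, h2⟩ := (hDoff m hJm).subset_and_isBlocky hH hm
    exact ⟨h1 (hsubH (Finset.mem_insert_self _ _)), hκ.isDisjointUnionOfRightTranslates h2⟩

end Stage

/-! ### Rates of decay and passage to Følner limits. -/

section Limits

theorem exists_antitone_rate {P : ℕ → ℝ → Prop} (hP1 : ∀ j, P j 1)
    (hP : ∀ ε : ℝ, 0 < ε → ∀ᶠ j in Filter.atTop, P j ε) :
    ∃ δ : ℕ → ℝ, Antitone δ ∧ Filter.Tendsto δ Filter.atTop (𝓝 0) ∧ (∀ j, δ j ≤ 1) ∧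
      ∀ j, P j (δ j) := by
  classical
  -- The condition is imposed on all `i ≥ j` to make `s` monotone, and `k = 0` always qualifies by
  -- `hP1`; no monotonicity of `P` in its real argument is needed.
  let s : ℕ → ℕ := fun j => Nat.findGreatest (fun k => ∀ i, j ≤ i → P i (1 / ((k : ℝ) + 1))) j
  have hs : Monotone s := fun i j hij =>
    Nat.findGreatest_mono (fun k hk l hl => hk l (hij.trans hl)) hij
  have hspec : ∀ j, ∀ i, j ≤ i → P i (1 / ((s j : ℝ) + 1)) := fun j =>
    Nat.findGreatest_spec (P := fun k => ∀ i, j ≤ i → P i (1 / ((k : ℝ) + 1))) (Nat.zero_le j)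
      (fun i _ => by simpa using hP1 i)
  have htop : Filter.Tendsto s Filter.atTop Filter.atTop := by
    refine Filter.tendsto_atTop.2 (fun k => ?_)
    obtain ⟨N, hN⟩ := Filter.eventually_atTop.1
      (hP (1 / ((k : ℝ) + 1)) Nat.one_div_pos_of_nat)
    filter_upwards [Filter.eventually_ge_atTop (max k N)] with j hj
    exact Nat.le_findGreatest ((le_max_left _ _).trans hj)
      (fun i hi => hN i (((le_max_right _ _).trans hj).trans hi))
  refine ⟨fun j => 1 / ((s j : ℝ) + 1), fun i j hij => Nat.one_div_le_one_div (hs hij),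
    tendsto_one_div_add_atTop_nhds_zero_nat.comp htop, fun j => ?_, fun j => hspec j j le_rfl⟩
  simpa using Nat.one_div_le_one_div (α := ℝ) (Nat.zero_le (s j))

variable {G : Type*} [Group G]

theorem exists_isTransv (M : Subgroup G) [M.FiniteIndex] : ∃ R : Finset G, IsTransv M R := by
  classical
  have : Fintype (G ⧸ M) := M.fintypeQuotientOfFiniteIndex
  refine ⟨Finset.univ.image (fun q : G ⧸ M => q.out), ?_, fun g =>
    ⟨_, Finset.mem_image_of_mem _ (Finset.mem_univ (g : G ⧸ M)), QuotientGroup.out_eq' _⟩⟩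
  intro x hx y hy hxy
  obtain ⟨q, _, rfl⟩ := Finset.mem_image.1 hx
  obtain ⟨q', _, rfl⟩ := Finset.mem_image.1 hy
  rw [QuotientGroup.out_eq', QuotientGroup.out_eq'] at hxy
  rw [hxy]

variable [DecidableEq G]

theorem card_symmDiff_image_smul (γ : G × G) (K : Finset G) :
    (K ∆ K.image (fun x => γ • x)).card = 2 * boundaryCard γ K := by
  have hinj : Function.Injective (fun x : G => γ • x) := MulAction.injective γ
  have h1 : (K.image (fun x => γ • x)).card = K.card := Finset.card_image_of_injective _ hinj
  have h2 : (K.image (fun x => γ • x) \ K).card = boundaryCard γ K := by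
    rw [boundaryCard, ← Finset.card_image_of_injective (K.filter (fun x => γ • x ∉ K)) hinj]
    congr 1
    ext y
    simp only [Finset.mem_sdiff, Finset.mem_image, Finset.mem_filter]
    constructor
    · rintro ⟨⟨x, hx, rfl⟩, h⟩
      exact ⟨x, ⟨hx, h⟩, rfl⟩
    · rintro ⟨x, ⟨hx, h⟩, rfl⟩
      exact ⟨⟨x, hx, rfl⟩, h⟩
  have h3 : (K \ K.image (fun x => γ • x)).card = (K.image (fun x => γ • x) \ K).card :=
    Finset.card_sdiff_comm h1.symm
  rw [symmDiff_def, Finset.sup_eq_union, Finset.card_union_of_disjoint disjoint_sdiff_sdiff]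
  omega

theorem IsWeight.tendsto_symmDiff {w : G × G → ℝ} (hw : IsWeight w) {K : ℕ → Finset G}
    (hK : ∀ j, (K j).Nonempty)
    (hd : ∀ τ : ℝ, 0 < τ → ∀ᶠ j in Filter.atTop, defect w (K j) ≤ τ * (K j).card) (γ : G × G) :
    Filter.Tendsto (fun n => (((K n) ∆ (K n).image (fun x => γ • x)).card : ℝ) / ((K n).card : ℝ))
      Filter.atTop (𝓝 0) := by
  have hwγ := hw.pos γ
  rw [tendsto_order]
  refine ⟨fun a ha => Filter.Eventually.of_forall (fun n => ha.trans_le (by positivity)),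
    fun a ha => ?_⟩
  filter_upwards [hd (w γ * a / 4) (by positivity)] with n hn
  have hpos : (0 : ℝ) < (K n).card := by exact_mod_cast (hK n).card_pos
  rw [div_lt_iff₀ hpos, card_symmDiff_image_smul]
  push_cast
  have h1 := (hw.mul_boundaryCard_le γ (K n)).trans hn
  have h2 : (boundaryCard γ (K n) : ℝ) ≤ a / 4 * (K n).card := by
    refine le_of_mul_le_mul_left (h1.trans_eq (by ring)) hwγ
  nlinarith [mul_pos ha hpos]

theorem isDisjointUnionOfRightTranslates_self (A : Finset G) :
    IsDisjointUnionOfRightTranslates A A :=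
  ⟨{1}, by simp, by ext x; simp only [Finset.singleton_biUnion, mul_one, Finset.image_id']⟩

end Limits

/-! ### Assembly for finite and for infinite groups. -/

section Main

variable {G : Type*} [Group G] [DecidableEq G]

theorem IsSeparatingNestedSeq.exists_folner_tilings_of_finite [Finite G] {L : ℕ → Subgroup G}
    (hL : IsSeparatingNestedSeq L) :
    ∃ (K : ℕ → Finset G) (n : ℕ → ℕ),
      IsLeftFolnerSeq K ∧ IsRightFolnerSeq K ∧
      (∀ i, Subgroup.IsComplement (K i : Set G) (L i : Set G)) ∧
      StrictMono n ∧
      ∀ k, IsDisjointUnionOfRightTranslates (K (n k)) (K (n (k + 1))) := by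
  have : Fintype G := Fintype.ofFinite G
  have hfi := hL.finiteIndex
  choose R hR using fun j => exists_isTransv (L j)
  let K : ℕ → Finset G := fun j => Nat.rec (extendMod (L 0) {1} (R 0))
    (fun j X => extendMod (L (j + 1)) X (R (j + 1))) j
  have hKsucc : ∀ j, K (j + 1) = extendMod (L (j + 1)) (K j) (R (j + 1)) := fun _ => rfl
  have hK : ∀ j, IsTransv (L j) (K j) := by
    intro j
    induction j with
    | zero =>
      refine IsTransv.extendMod ?_ (hR 0)
      intro x hx y hy _
      rw [Finset.mem_singleton.1 hx, Finset.mem_singleton.1 hy]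
    | succ j ih => exact IsTransv.extendMod (ih.sep.of_le (hL.nested (Nat.le_succ j))) (hR _)
  have h1 : (1 : G) ∈ K 0 := subset_extendMod _ _ _ (Finset.mem_singleton_self 1)
  have hmono : Monotone K := monotone_nat_of_le_succ (fun j => by
    rw [hKsucc]; exact subset_extendMod _ _ _)
  -- From `j₀` on the subgroups separate all points of the finite group, so the transversals are the
  -- whole group.
  obtain ⟨j₀, hj₀⟩ := Filter.eventually_atTop.1 (hL.eventually_sepMod Finset.univ)
  have huniv : ∀ j, j₀ ≤ j → K j = Finset.univ := fun j hj => by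
    refine Finset.eq_univ_of_forall (fun g => ?_)
    obtain ⟨x, hx, hxg⟩ := (hK j).cover g
    rwa [← hj₀ j hj x (Finset.mem_univ _) g (Finset.mem_univ _) hxg]
  have hex : ∀ g : G, ∃ n, g ∈ K n := fun g => ⟨j₀, by rw [huniv j₀ le_rfl]; simp⟩
  have hlim : ∀ f : G → G, Function.Injective f → Filter.Tendsto
      (fun n => ((K n ∆ (K n).image f).card : ℝ) / ((K n).card : ℝ)) Filter.atTop (𝓝 0) := by
    intro f hf
    refine tendsto_const_nhds.congr' ?_
    filter_upwards [Filter.eventually_ge_atTop j₀] with j hj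
    rw [huniv j hj, Finset.image_univ_of_surjective (Finite.surjective_of_injective hf)]
    simp
  refine ⟨K, fun k => j₀ + k, ⟨h1, hmono, hex, fun s => hlim _ (mul_right_injective s)⟩,
    ⟨h1, hmono, hex, fun s => hlim _ (mul_left_injective s)⟩, fun i => (hK i).isComplement,
    fun i j h => by simpa using h, fun k => ?_⟩
  rw [huniv _ (Nat.le_add_right _ _), huniv _ (Nat.le_add_right _ _)]
  exact isDisjointUnionOfRightTranslates_self _

theorem IsAmenableGroup.exists_folner_tilings_of_infinite [Countable G] [Infinite G]
    (hG : IsAmenableGroup G) {L : ℕ → Subgroup G} (hL : IsSeparatingNestedSeq L) :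
    ∃ (K : ℕ → Finset G) (n : ℕ → ℕ),
      IsLeftFolnerSeq K ∧ IsRightFolnerSeq K ∧
      (∀ i, Subgroup.IsComplement (K i : Set G) (L i : Set G)) ∧
      StrictMono n ∧
      ∀ k, IsDisjointUnionOfRightTranslates (K (n k)) (K (n (k + 1))) := by
  have hfi := hL.finiteIndex
  obtain ⟨w, hw⟩ := exists_isWeight (G := G)
  obtain ⟨δ, hδ, hδ0, hδ1, hRδ⟩ := exists_antitone_rate
    (P := fun j ε => ∃ R : Finset G, IsTransv (L j) R ∧ defect w R ≤ ε * R.card)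
    (fun j => (exists_isTransv (L j)).imp (fun R hR => ⟨hR, by
      rw [one_mul]; exact hw.defect_le_card R⟩))
    (fun ε hε => hG.eventually_exists_defect_le hL hw hε)
  choose R hR hRδ using hRδ
  obtain ⟨g, hg⟩ := exists_surjective_nat G
  let ε : ℕ → ℝ := fun k => (1 / 2) ^ k
  have hε : ∀ k, 0 < ε k := fun k => by positivity
  have hεanti : Antitone ε := fun i j h =>
    pow_le_pow_of_le_one (by norm_num) (by norm_num) h
  have hε0 : Filter.Tendsto ε Filter.atTop (𝓝 0) :=
    tendsto_pow_atTop_nhds_zero_of_lt_one (by norm_num) (by norm_num)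
  have hsep1 : SepMod (L 0) ({1} : Finset G) := by
    intro x hx y hy _
    rw [Finset.mem_singleton.1 hx, Finset.mem_singleton.1 hy]
  obtain ⟨K, n, hn0, hK0, hn, hrel, hinv, hlink⟩ := exists_concat
    (Inv := fun k p K => IsTransv (L p) K ∧ defect w K ≤ ε k * K.card ∧ δ p ≤ ε k)
    -- Before `J` the defect is at most `ε k + 5 * δ p`, and `δ p ≤ ε k`; this gives the `6`.
    (Rel := fun k j A B => IsTransv (L j) A ∧ A ⊆ B ∧ defect w A ≤ 6 * ε k * A.card)
    (Link := fun k A B => g k ∈ B ∧ IsDisjointUnionOfRightTranslates A B)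
    (by
      rintro k p A ⟨hA, hAε, hδp⟩
      obtain ⟨C, hCp, hCj, hC0⟩ := hL.exists_chain hw hR hδ hδ0 hRδ hA (hε k).le hAε
      obtain ⟨D, J, hpJ, hDC, hDj, hDm⟩ := hL.exists_blocky_chain hw hR hA
        (fun j hj => ⟨(hCj j hj).1, (hCj j hj).2.1⟩) hC0 (g k) (hε (k + 1))
      obtain ⟨m, ⟨hgm, hAm⟩, hδm, hJm⟩ := (hDm.and ((hδ0.eventually_le_const (hε (k + 1))).and
        (Filter.eventually_gt_atTop J))).exists
      refine ⟨D, m, hpJ.trans hJm, by rw [hDC p hpJ.le, hCp], fun j hj _ => ?_,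
        ⟨(hDj m hJm.le).1, (hDj m hJm.le).2.2, hδm⟩, hgm, hAm⟩
      rcases lt_or_ge j J with h | h
      · rw [hDC j h.le, hDC (j + 1) h]
        refine ⟨(hCj j hj).1, (hCj j hj).2.1, (hCj j hj).2.2.trans
          (mul_le_mul_of_nonneg_right ?_ (Nat.cast_nonneg _))⟩
        linarith
      · refine ⟨(hDj j h).1, (hDj j h).2.1, (hDj j h).2.2.trans
          (mul_le_mul_of_nonneg_right ?_ (Nat.cast_nonneg _))⟩
        have hk : ε (k + 1) ≤ ε k := hεanti (Nat.le_succ k)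
        linarith [hε k])
    (p₀ := 0) (K₀ := extendMod (L 0) {1} (R 0))
    -- As `ε 0 = 1`, the initial defect bound is the trivial one.
    ⟨IsTransv.extendMod hsep1 (hR 0), by
      simp only [ε, pow_zero, one_mul]; exact hw.defect_le_card _, by
      simp only [ε, pow_zero]; exact hδ1 0⟩
  have hmem : ∀ j, ∃ k, n k ≤ j ∧ j < n (k + 1) := fun j =>
    hn.exists_mem_interval (by rw [hn0]; exact Nat.zero_le j)
  have hT : ∀ j, IsTransv (L j) (K j) := fun j => by
    obtain ⟨k, h1, h2⟩ := hmem j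
    exact (hrel k j h1 h2).1
  have hmono : Monotone K := monotone_nat_of_le_succ (fun j => by
    obtain ⟨k, h1, h2⟩ := hmem j
    exact (hrel k j h1 h2).2.1)
  have h1 : (1 : G) ∈ K 0 := by
    rw [hK0]
    exact subset_extendMod _ _ _ (Finset.mem_singleton_self 1)
  have hex : ∀ x : G, ∃ i, x ∈ K i := fun x => by
    obtain ⟨k, rfl⟩ := hg x
    exact ⟨n (k + 1), (hlink k).1⟩
  have hd : ∀ τ : ℝ, 0 < τ → ∀ᶠ j in Filter.atTop, defect w (K j) ≤ τ * (K j).card := by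
    intro τ hτ
    obtain ⟨k₀, hk₀⟩ := (hε0.eventually_le_const (show (0 : ℝ) < τ / 6 by positivity)).exists
    filter_upwards [Filter.eventually_ge_atTop (n k₀)] with j hj
    obtain ⟨k, h2, h3⟩ := hmem j
    have hk : k₀ ≤ k := by
      by_contra! h
      exact absurd (h3.trans_le (hn.monotone h)) (not_lt.2 hj)
    refine (hrel k j h2 h3).2.2.trans (mul_le_mul_of_nonneg_right ?_ (Nat.cast_nonneg _))
    linarith [hεanti hk]
  have hlim := hw.tendsto_symmDiff (fun j => ⟨1, hmono (Nat.zero_le j) h1⟩) hd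
  refine ⟨K, n, ⟨h1, hmono, hex, fun s => ?_⟩, ⟨h1, hmono, hex, fun s => ?_⟩,
    fun i => (hT i).isComplement, hn, fun k => (hlink k).2⟩
  · simpa [twoSided_smul_def] using hlim (s, 1)
  -- The second coordinate acts through its inverse, so `(1, s⁻¹)` is right multiplication by `s`.
  · simpa [twoSided_smul_def] using hlim (1, s⁻¹)

end Main

theorem theorem4 {G : Type*} [Group G] [DecidableEq G] [Countable G]
    [Group.ResiduallyFinite G] (hG : IsAmenableGroup G)
    (L : ℕ → Subgroup G) (hL : IsSeparatingNestedSeq L) :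
    ∃ (K : ℕ → Finset G) (n : ℕ → ℕ),
      IsLeftFolnerSeq K ∧ IsRightFolnerSeq K ∧
      (∀ i, Subgroup.IsComplement (K i : Set G) (L i : Set G)) ∧
      StrictMono n ∧
      ∀ k, IsDisjointUnionOfRightTranslates (K (n k)) (K (n (k + 1))) := by
  rcases finite_or_infinite G with _ | _
  · exact hL.exists_folner_tilings_of_finite
  · exact hG.exists_folner_tilings_of_infinite hL
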